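/- Let $\mathbf{S}$ be the Sorgenfrey line, that is, the set $\mathbb{R}$ with the topology generated by the half-open intervals $[a,b)$, $a<b$. A topological space is called analytic (absolute Borel) if it is homeomorphic to an analytic (Borel) subset of some Polish space. A surjective map $f:X\to Y$ of topological spaces is called - quotient if for every $A\subseteq Y$, the preimage $f^{-1}(A)$ is open in $X$ if and only if $A$ is open in $Y$; - pseudo-open if for every $y\in Y$ and every open $U\subseteq X$ with $f^{-1}(y)\subseteq U$, the point $y$ belongs to the interior of $f(U)$; - biquotient if for every $y\in Y$ and every family $\mathcal{U}$ of open subsets of $X$ that covers $f^{-1}(y)$, there is a finite subfamily $\mathcal{V}\subseteq\mathcal{U}$ such that $y$ belongs to the interior of $\bigcup_{U\in\mathcal{V}}f(U)$. Let $Y$ be a metrizable space. Then: (i) there is a continuous map of $\mathbf{S}$ onto $Y$ if and only if $Y$ is a nonempty analytic space; (ii) there is a continuous bijection of $\mathbf{S}$ onto $Y$ if and only if $Y$ is a nonempty absolute Borel space in which every nonempty open subset is uncountable; (iii) each of the following three conditions is equivalent to $Y$ being a nonempty analytic space: there is a continuous quotient map of $\mathbf{S}$ onto $Y$; there is a continuous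 biquotient map of $\mathbf{S}$ onto $Y$; there is a continuous pseudo-open map of $\mathbf{S}$ onto $Y$. -/

import Mathlib

open Set Topology

universe u v

/-- The Sorgenfrey line: the set of real numbers, as a type of its own, so that it does not carry
the Euclidean topology. -/
def SorgenfreyLine : Type := ℝ

/-- The topology of the Sorgenfrey line, generated by the half-open intervals `[a, b)`, `a < b`. -/
instance SorgenfreyLine.instTopologicalSpace : TopologicalSpace SorgenfreyLine :=
  TopologicalSpace.generateFrom {U : Set ℝ | ∃ a b : ℝ, a < b ∧ U = Ico a b}

/-- A space is analytic if it is homeomorphic to an analytic subset of some Polish space. -/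
def IsAnalyticSpace (X : Type u) [TopologicalSpace X] : Prop :=
  ∃ (P : Type u) (_ : TopologicalSpace P) (_ : PolishSpace P) (s : Set P),
    MeasureTheory.AnalyticSet s ∧ Nonempty (X ≃ₜ s)

/-- A space is absolute Borel if it is homeomorphic to a Borel subset of some Polish space. -/
def IsAbsoluteBorelSpace (X : Type u) [TopologicalSpace X] : Prop :=
  ∃ (P : Type u) (_ : TopologicalSpace P) (_ : PolishSpace P) (s : Set P),
    @MeasurableSet P (borel P) s ∧ Nonempty (X ≃ₜ s)

/-- A surjective map `f : X → Y` is pseudo-open if for every point `y` of `Y` and every open set `U`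
that contains the fiber of `y`, the point `y` is interior to the image of `U`. -/
structure IsPseudoOpenMap {X : Type u} {Y : Type v} [TopologicalSpace X] [TopologicalSpace Y]
    (f : X → Y) : Prop where
  surjective : Function.Surjective f
  mem_interior_image : ∀ (y : Y) (U : Set X), IsOpen U → f ⁻¹' {y} ⊆ U → y ∈ interior (f '' U)

/-- A surjective map `f : X → Y` is biquotient if for every point `y` of `Y`, whenever a family of
open sets of `X` covers the fiber of `y`, the images of finitely many members of the family
cover a neighborhood of `y`. -/
structure IsBiquotientMap {X : Type u} {Y : Type v} [TopologicalSpace X] [TopologicalSpace Y]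
    (f : X → Y) : Prop where
  surjective : Function.Surjective f
  exists_finite_mem_interior : ∀ (y : Y) (𝒰 : Set (Set X)), (∀ U ∈ 𝒰, IsOpen U) →
    f ⁻¹' {y} ⊆ ⋃₀ 𝒰 → ∃ 𝒱 ⊆ 𝒰, 𝒱.Finite ∧ y ∈ interior (⋃ U ∈ 𝒱, f '' U)

/-! Sufficiency goes through the Baire space `ℕ → ℕ`. Coding the integer part of a number, together
with the gaps between the ones in the nonterminating binary expansion of one minus its fractional
part, gives a continuous bijection `expansion` of the Sorgenfrey line onto `ℕ → ℕ`. Moreover, each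
neighborhood of `s` contains, for some `n`, all points whose code agrees with that of `s` before `n`
and is larger at `n`.

For analytic `Y`, let `ψ` map `ℕ → ℕ` continuously onto `Y`. Each term of a code carries a term of
an argument `u` of `ψ` and a parity bit. All-even codes go to `ψ u`; a first odd term at `n` lets
the remaining terms sweep a small open set around `ψ u`. Raising an even term to the next odd one
stays inside the given neighborhood, so the map is open at all-even codes. Such an almost open map
is quotient, biquotient and pseudo-open at once.

For Borel `Y` without nonempty countable open sets, a continuous bijection from `ℕ → ℕ` is enough.
`Y` is a continuous bijective image of a closed subset of `ℕ → ℕ`; the perfect kernel of the latter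
is an injective Baire image up to a countable set (`Perfect.exists_isInjectiveBaireImage`). The
countably many missing points of `Y` are absorbed as limits of disjoint sequences of pieces
(`IsInjectiveBaireImage.univ_of_countable_compl`).

Necessity: a right-continuous map is a limit of dyadic step functions, hence Borel, so its image is
analytic, and Borel if the map is injective (Lusin–Souslin). -/

open Filter Function

/-! ### Neighborhoods and continuity in the Sorgenfrey line -/

/-- The tautological identification of the Sorgenfrey line with the real numbers. -/
def SorgenfreyLine.ofReal : ℝ ≃ SorgenfreyLine := Equiv.refl ℝ

namespace SorgenfreyLine

theorem mem_nhds_ofReal {x : ℝ} {U : Set SorgenfreyLine} :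
    U ∈ 𝓝 (ofReal x) ↔ ∃ b > x, Ico x b ⊆ ofReal ⁻¹' U := by
  constructor
  · intro h
    obtain ⟨V, hVU, hV, hxV⟩ := mem_nhds_iff.1 h
    clear h
    suffices h : ∃ b > x, Ico x b ⊆ ofReal ⁻¹' V from
      h.imp fun b hb => ⟨hb.1, hb.2.trans (preimage_mono hVU)⟩
    clear hVU
    induction hV with
    | basic s hs =>
      obtain ⟨a, b, -, rfl⟩ := hs
      exact ⟨b, hxV.2, fun y hy => ⟨le_trans hxV.1 hy.1, hy.2⟩⟩
    | univ => exact ⟨x + 1, by simp, fun _ _ => mem_univ _⟩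
    | inter s t _ _ ihs iht =>
      obtain ⟨b, hb, hbs⟩ := ihs hxV.1
      obtain ⟨c, hc, hct⟩ := iht hxV.2
      exact ⟨min b c, lt_min hb hc, fun y hy =>
        ⟨hbs ⟨hy.1, hy.2.trans_le (min_le_left _ _)⟩, hct ⟨hy.1, hy.2.trans_le (min_le_right _ _)⟩⟩⟩
    | sUnion S _ ih =>
      obtain ⟨s, hs, hxs⟩ := hxV
      obtain ⟨b, hb, hbs⟩ := ih s hs hxs
      exact ⟨b, hb, fun y hy => ⟨s, hs, hbs hy⟩⟩
  · rintro ⟨b, hb, hbU⟩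
    exact mem_nhds_iff.2 ⟨ofReal.symm ⁻¹' Ico x b, fun y hy => hbU hy,
      .basic _ ⟨x, b, hb, rfl⟩, ⟨le_rfl, hb⟩⟩

theorem nhds_ofReal (x : ℝ) : 𝓝 (ofReal x) = map ofReal (𝓝[≥] x) := by
  ext U
  rw [mem_nhds_ofReal, mem_map, mem_nhdsGE_iff_exists_Ico_subset]
  rfl

theorem continuous_iff {Y : Type*} [TopologicalSpace Y] {f : SorgenfreyLine → Y} :
    Continuous f ↔ ∀ x : ℝ, ContinuousWithinAt (f ∘ ofReal) (Ici x) x := by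
  rw [continuous_iff_continuousAt, ofReal.surjective.forall]
  refine forall_congr' fun x => ?_
  rw [ContinuousAt, nhds_ofReal, tendsto_map'_iff]
  rfl

end SorgenfreyLine

/-! ### Sequences of natural numbers -/

section Sequences

variable {α : Type*}

/-- The sequence with first term `a`, followed by the terms of `z`. -/
def seqCons (a : α) (z : ℕ → α) : ℕ → α
  | 0 => a
  | k + 1 => z k

@[simp] theorem seqCons_zero (a : α) (z : ℕ → α) : seqCons a z 0 = a := rfl

@[simp] theorem seqCons_succ (a : α) (z : ℕ → α) (k : ℕ) : seqCons a z (k + 1) = z k := rfl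

theorem seqCons_head_tail (z : ℕ → α) : seqCons (z 0) (fun k => z (k + 1)) = z := by
  funext k
  cases k <;> rfl

/-- The sequence that agrees with `x` before the index `n`, where it goes on with `z`. -/
def seqAppend (x : ℕ → α) (n : ℕ) (z : ℕ → α) : ℕ → α :=
  fun k => if k < n then x k else z (k - n)

theorem seqAppend_of_lt {x : ℕ → α} {n : ℕ} {z : ℕ → α} {k : ℕ} (h : k < n) :
    seqAppend x n z k = x k := if_pos h

@[simp] theorem seqAppend_add (x : ℕ → α) (n : ℕ) (z : ℕ → α) (k : ℕ) :
    seqAppend x n z (n + k) = z k := by simp [seqAppend]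

theorem seqAppend_tail {x y : ℕ → α} {n : ℕ} (h : ∀ i < n, y i = x i) :
    seqAppend x n (fun k => y (n + k)) = y := by
  funext k
  rcases lt_or_ge k n with hk | hk
  · rw [seqAppend_of_lt hk, h k hk]
  · simp [seqAppend, not_lt.2 hk, Nat.add_sub_cancel' hk]

variable [TopologicalSpace α]

theorem continuous_seqCons (a : α) : Continuous (seqCons a) :=
  continuous_pi fun k => by
    cases k with
    | zero => exact continuous_const
    | succ k => exact continuous_apply k

theorem continuous_seqAppend (x : ℕ → α) (n : ℕ) : Continuous (seqAppend x n) :=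
  continuous_pi fun k => by
    by_cases hk : k < n
    · simpa [seqAppend, hk] using continuous_const
    · simpa [seqAppend, hk] using continuous_apply (k - n)

variable [DiscreteTopology α]

theorem cylinder_mem_nhds (z : ℕ → α) (n : ℕ) : PiNat.cylinder z n ∈ 𝓝 z :=
  (PiNat.isOpen_cylinder _ z n).mem_nhds (PiNat.self_mem_cylinder z n)

theorem exists_cylinder_subset {z : ℕ → α} {U : Set (ℕ → α)} (hU : U ∈ 𝓝 z) (k : ℕ) :
    ∃ n ≥ k, PiNat.cylinder z n ⊆ U := by
  obtain ⟨s, ⟨y, n, rfl⟩, hz, hs⟩ :=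
    (PiNat.isTopologicalBasis_cylinders fun _ : ℕ => α).mem_nhds_iff.1 hU
  rw [← PiNat.mem_cylinder_iff_eq.1 hz] at hs
  exact ⟨max k n, le_max_left _ _, (PiNat.cylinder_anti z (le_max_right _ _)).trans hs⟩

theorem isClosed_cylinder (z : ℕ → α) (n : ℕ) : IsClosed (PiNat.cylinder z n) := by
  rw [PiNat.cylinder_eq_pi]
  exact isClosed_set_pi fun _ _ => isClosed_discrete _

end Sequences

/-! ### Expansion of the points of the Sorgenfrey line -/

namespace SorgenfreyLine

/-- The weighted sum of the powers of `1 / 2` that is coded by a sequence of gaps. -/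
noncomputable def gapSum (z : ℕ → ℕ) : ℝ :=
  ∑' k, ∏ i ∈ Finset.range (k + 1), (1 / 2 : ℝ) ^ (z i + 1)

theorem prod_gap_le (z : ℕ → ℕ) (k : ℕ) :
    ∏ i ∈ Finset.range (k + 1), (1 / 2 : ℝ) ^ (z i + 1) ≤ 1 / 2 / 2 ^ k := by
  calc ∏ i ∈ Finset.range (k + 1), (1 / 2 : ℝ) ^ (z i + 1)
      ≤ ∏ i ∈ Finset.range (k + 1), (1 / 2 : ℝ) :=
        Finset.prod_le_prod (fun i _ => by positivity) fun i _ =>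
          (pow_le_pow_of_le_one (by norm_num) (by norm_num) (Nat.le_add_left 1 (z i))).trans_eq
            (pow_one _)
    _ = 1 / 2 / 2 ^ k := by simp [pow_succ]; field_simp

theorem summable_gap (z : ℕ → ℕ) :
    Summable fun k => ∏ i ∈ Finset.range (k + 1), (1 / 2 : ℝ) ^ (z i + 1) :=
  Summable.of_nonneg_of_le (fun k => Finset.prod_nonneg fun i _ => by positivity) (prod_gap_le z)
    (summable_geometric_two' 1)

/-- Self-similarity of the expansion: dropping the first gap is undone by an increasing affine
contraction. The later inductions rest on this recursion. -/
theorem gapSum_eq (z : ℕ → ℕ) :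
    gapSum z = (1 / 2 : ℝ) ^ (z 0 + 1) * (1 + gapSum fun k => z (k + 1)) := by
  rw [gapSum, (summable_gap z).tsum_eq_zero_add, gapSum, mul_add, ← tsum_mul_left]
  refine congrArg₂ _ (by simp) (tsum_congr fun k => ?_)
  rw [Finset.prod_range_succ', mul_comm]

theorem gapSum_pos (z : ℕ → ℕ) : 0 < gapSum z :=
  (summable_gap z).tsum_pos (fun k => Finset.prod_nonneg fun i _ => by positivity) 0
    (Finset.prod_pos fun i _ => by positivity)

theorem gapSum_le_one (z : ℕ → ℕ) : gapSum z ≤ 1 :=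
  ((summable_gap z).tsum_le_tsum (prod_gap_le z) (summable_geometric_two' 1)).trans_eq
    (tsum_geometric_two' 1)

theorem exists_gap {x : ℝ} (hx : x ∈ Ioc (0 : ℝ) 1) :
    ∃ n : ℕ, (1 / 2 : ℝ) ^ (n + 1) < x ∧ x ≤ (1 / 2 : ℝ) ^ n :=
  exists_nat_pow_near_of_lt_one hx.1 hx.2 (by norm_num) (by norm_num)

/-- The exponent of the first power of `1 / 2` in the expansion of a point of `(0, 1]`. -/
noncomputable def gap (x : ℝ) : ℕ := open Classical in
  if hx : x ∈ Ioc (0 : ℝ) 1 then (exists_gap hx).choose else 0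

theorem gap_spec {x : ℝ} (hx : x ∈ Ioc (0 : ℝ) 1) :
    (1 / 2 : ℝ) ^ (gap x + 1) < x ∧ x ≤ (1 / 2 : ℝ) ^ gap x := by
  rw [gap, dif_pos hx]
  exact (exists_gap hx).choose_spec

theorem gap_anti {x y : ℝ} (hx : x ∈ Ioc (0 : ℝ) 1) (hy : y ∈ Ioc (0 : ℝ) 1) (h : x ≤ y) :
    gap y ≤ gap x := by
  have h1 := ((gap_spec hx).1.trans_le h).trans_le (gap_spec hy).2
  have := (pow_lt_pow_iff_right_of_lt_one₀ (by norm_num : (0 : ℝ) < 1 / 2) (by norm_num)).1 h1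
  omega

theorem gap_eq {x : ℝ} {n : ℕ} (h1 : (1 / 2 : ℝ) ^ (n + 1) < x) (h2 : x ≤ (1 / 2 : ℝ) ^ n) :
    gap x = n := by
  have hx : x ∈ Ioc (0 : ℝ) 1 :=
    ⟨lt_trans (by positivity) h1, h2.trans (pow_le_one₀ (by norm_num) (by norm_num))⟩
  have h3 := (pow_lt_pow_iff_right_of_lt_one₀ (by norm_num : (0 : ℝ) < 1 / 2) (by norm_num)).1
    ((gap_spec hx).1.trans_le h2)
  have h4 := (pow_lt_pow_iff_right_of_lt_one₀ (by norm_num : (0 : ℝ) < 1 / 2) (by norm_num)).1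
    (h1.trans_le (gap_spec hx).2)
  omega

/-- The remainder of the expansion of a point of `(0, 1]` after its first term, rescaled. -/
noncomputable def gapShift (x : ℝ) : ℝ := 2 ^ (gap x + 1) * x - 1

theorem eq_gapShift (x : ℝ) : x = (1 / 2 : ℝ) ^ (gap x + 1) * (1 + gapShift x) := by
  rw [gapShift, one_div_pow]
  field_simp
  ring

theorem gapShift_mem {x : ℝ} (hx : x ∈ Ioc (0 : ℝ) 1) : gapShift x ∈ Ioc (0 : ℝ) 1 := by
  have h := gap_spec hx
  rw [one_div_pow, one_div_pow, div_lt_iff₀ (by positivity), le_div_iff₀ (by positivity)] at h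
  have h2 : (2 : ℝ) ^ (gap x + 1) = 2 * 2 ^ gap x := pow_succ' _ _
  exact ⟨by rw [gapShift]; linarith, by rw [gapShift, h2]; linarith⟩

/-- The sequence of gaps in the expansion of a point of `(0, 1]`. -/
noncomputable def gaps (x : ℝ) (k : ℕ) : ℕ := gap (gapShift^[k] x)

@[simp] theorem gaps_zero (x : ℝ) : gaps x 0 = gap x := rfl

@[simp] theorem gaps_succ (x : ℝ) (k : ℕ) : gaps x (k + 1) = gaps (gapShift x) k := rfl

theorem gap_gapSum (z : ℕ → ℕ) : gap (gapSum z) = z 0 := by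
  have h1 := gapSum_pos fun k => z (k + 1)
  have h2 := gapSum_le_one fun k => z (k + 1)
  have h3 : (0 : ℝ) < (1 / 2) ^ (z 0 + 1) := by positivity
  apply gap_eq
  · rw [gapSum_eq]; nlinarith
  · have h4 : (1 / 2 : ℝ) ^ z 0 = 2 * (1 / 2) ^ (z 0 + 1) := by rw [pow_succ]; ring
    rw [gapSum_eq, h4]; nlinarith

theorem gapShift_gapSum (z : ℕ → ℕ) : gapShift (gapSum z) = gapSum fun k => z (k + 1) := by
  rw [gapShift, gap_gapSum, gapSum_eq, one_div_pow]
  field_simp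
  ring

theorem gaps_gapSum (z : ℕ → ℕ) : gaps (gapSum z) = z := by
  funext k
  induction k generalizing z with
  | zero => exact gap_gapSum z
  | succ k ih => rw [gaps_succ, gapShift_gapSum, ih]

/-- A common first gap places both points in the image of one affine map of ratio at most `1 / 2`.
-/
theorem abs_sub_le_of_gaps_eq {n : ℕ} {x y : ℝ} (hx : x ∈ Ioc (0 : ℝ) 1) (hy : y ∈ Ioc (0 : ℝ) 1)
    (h : ∀ i < n, gaps x i = gaps y i) : |x - y| ≤ (1 / 2) ^ n := by
  induction n generalizing x y with
  | zero => rw [abs_le]; constructor <;> simp <;> linarith [hx.1, hx.2, hy.1, hy.2]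
  | succ n ih =>
    have h0 : gap x = gap y := h 0 n.succ_pos
    have h1 := ih (gapShift_mem hx) (gapShift_mem hy) fun i hi => h (i + 1) (Nat.succ_lt_succ hi)
    rw [eq_gapShift x, eq_gapShift y, h0, ← mul_sub, abs_mul, abs_of_pos (by positivity),
      add_sub_add_left_eq_sub, pow_succ' _ n]
    refine mul_le_mul ?_ h1 (abs_nonneg _) (by norm_num)
    exact (pow_le_pow_of_le_one (by norm_num) (by norm_num) (Nat.le_add_left 1 _)).trans_eq
      (pow_one _)

/-- A longer gap means a smaller number, and the affine maps that prepend a common gap preserve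
order. -/
theorem lt_of_gaps_lt {n : ℕ} {x y : ℝ} (hx : x ∈ Ioc (0 : ℝ) 1) (hy : y ∈ Ioc (0 : ℝ) 1)
    (h : ∀ i < n, gaps x i = gaps y i) (hn : gaps x n < gaps y n) : y < x := by
  induction n generalizing x y with
  | zero =>
    by_contra! hxy
    exact (gap_anti hx hy hxy).not_gt hn
  | succ n ih =>
    have h0 : gap x = gap y := h 0 n.succ_pos
    have h1 := ih (gapShift_mem hx) (gapShift_mem hy) (fun i hi => h (i + 1) (Nat.succ_lt_succ hi)) hn
    rw [eq_gapShift x, eq_gapShift y, h0]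
    gcongr

/-- Every initial segment of the sequence of gaps is constant to the left of a point. -/
theorem exists_gaps_eq (n : ℕ) {x : ℝ} (hx : x ∈ Ioc (0 : ℝ) 1) :
    ∃ a < x, ∀ y ∈ Ioc a x, y ∈ Ioc (0 : ℝ) 1 ∧ ∀ i < n, gaps y i = gaps x i := by
  induction n generalizing x with
  | zero => exact ⟨0, hx.1, fun y hy => ⟨⟨hy.1, hy.2.trans hx.2⟩, fun i hi => absurd hi i.not_lt_zero⟩⟩
  | succ n ih =>
    obtain ⟨a, ha, h⟩ := ih (gapShift_mem hx)
    have hp : (0 : ℝ) < (1 / 2) ^ (gap x + 1) := by positivity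
    refine ⟨max ((1 / 2 : ℝ) ^ (gap x + 1)) ((1 / 2 : ℝ) ^ (gap x + 1) * (1 + a)),
      max_lt (gap_spec hx).1 ?_, fun y hy => ?_⟩
    · conv_rhs => rw [eq_gapShift x]
      gcongr
    · have hgap : gap y = gap x :=
        gap_eq ((le_max_left _ _).trans_lt hy.1) (hy.2.trans (gap_spec hx).2)
      have hy' : (1 / 2 : ℝ) ^ (gap x + 1) * (1 + a) < y := (le_max_right _ _).trans_lt hy.1
      have hy2 : (1 / 2 : ℝ) ^ (gap x + 1) * (1 + gapShift y)
          ≤ (1 / 2 : ℝ) ^ (gap x + 1) * (1 + gapShift x) := by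
        rw [← eq_gapShift x, ← hgap, ← eq_gapShift y]
        exact hy.2
      rw [eq_gapShift y, hgap] at hy'
      have h1 := lt_of_mul_lt_mul_left hy' hp.le
      have h2 := le_of_mul_le_mul_left hy2 hp
      obtain ⟨-, h3⟩ := h (gapShift y) ⟨by linarith, by linarith⟩
      refine ⟨⟨hp.trans ((le_max_left _ _).trans_lt hy.1), hy.2.trans hx.2⟩, fun i hi => ?_⟩
      cases i with
      | zero => exact hgap
      | succ i => exact h3 i (Nat.lt_of_succ_lt_succ hi)

/-- The expansion of a point of the Sorgenfrey line. -/
noncomputable def expansion (s : SorgenfreyLine) : ℕ → ℕ :=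
  -- The reflection `1 - Int.fract` takes `[0, 1)` onto `(0, 1]` and turns right neighborhoods into
  -- left ones, on which initial gaps are constant.
  seqCons (Equiv.intEquivNat ⌊ofReal.symm s⌋) (gaps (1 - Int.fract (ofReal.symm s)))

theorem one_sub_fract_mem (x : ℝ) : 1 - Int.fract x ∈ Ioc (0 : ℝ) 1 :=
  ⟨by linarith [Int.fract_lt_one x], by linarith [Int.fract_nonneg x]⟩

theorem expansion_injective : Injective expansion := by
  intro s t h
  have h0 : ⌊ofReal.symm s⌋ = ⌊ofReal.symm t⌋ := Equiv.intEquivNat.injective (congrFun h 0)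
  have h1 : 1 - Int.fract (ofReal.symm s) = 1 - Int.fract (ofReal.symm t) := by
    have key : ∀ n : ℕ, |(1 - Int.fract (ofReal.symm s)) - (1 - Int.fract (ofReal.symm t))|
        ≤ (1 / 2) ^ n := fun n =>
      abs_sub_le_of_gaps_eq (one_sub_fract_mem _) (one_sub_fract_mem _) fun i _ =>
        congrFun h (i + 1)
    have := ge_of_tendsto' (tendsto_pow_atTop_nhds_zero_of_lt_one (by norm_num)
      (by norm_num : (1 / 2 : ℝ) < 1)) key
    exact sub_eq_zero.1 (abs_nonpos_iff.1 this)
  apply ofReal.symm.injective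
  rw [← Int.floor_add_fract (ofReal.symm s), ← Int.floor_add_fract (ofReal.symm t), h0,
    sub_right_injective h1]

theorem expansion_surjective : Surjective expansion := by
  intro z
  set x := gapSum fun k => z (k + 1) with hx
  have hx1 : 0 < x := gapSum_pos _
  have hx2 : x ≤ 1 := gapSum_le_one _
  have hfl : ⌊(Equiv.intEquivNat.symm (z 0) : ℝ) + (1 - x)⌋ = Equiv.intEquivNat.symm (z 0) := by
    rw [Int.floor_eq_iff]; constructor <;> linarith
  refine ⟨ofReal (Equiv.intEquivNat.symm (z 0) + (1 - x)), ?_⟩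
  rw [expansion, Equiv.symm_apply_apply, hfl, Int.fract, hfl, Equiv.apply_symm_apply,
    add_sub_cancel_left, sub_sub_cancel, hx, gaps_gapSum, seqCons_head_tail]

theorem expansion_bijective : Bijective expansion := ⟨expansion_injective, expansion_surjective⟩

theorem continuous_expansion : Continuous expansion := by
  rw [continuous_iff]
  intro x
  rw [ContinuousWithinAt, tendsto_pi_nhds]
  intro k
  refine tendsto_nhds_of_eventually_eq ?_
  obtain ⟨a, ha, h⟩ := exists_gaps_eq k (one_sub_fract_mem x)
  have hlt : x < min ((⌊x⌋ : ℝ) + 1) (x + (1 - Int.fract x - a)) :=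
    lt_min (Int.lt_floor_add_one x) (by linarith)
  filter_upwards [Ico_mem_nhdsGE hlt] with y hy
  have hy1 : ⌊y⌋ = ⌊x⌋ := by
    rw [Int.floor_eq_iff]
    exact ⟨(Int.floor_le x).trans hy.1, hy.2.trans_le (min_le_left _ _)⟩
  have hy2 : y < x + (1 - Int.fract x - a) := hy.2.trans_le (min_le_right _ _)
  have hy3 : x ≤ y := hy.1
  cases k with
  | zero => simp [expansion, hy1]
  | succ k =>
    have hf : Int.fract y = Int.fract x + (y - x) := by rw [Int.fract, Int.fract, hy1]; ring
    simp only [comp_apply, expansion, Equiv.symm_apply_apply, seqCons_succ]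
    exact (h _ ⟨by rw [hf]; linarith, by rw [hf]; linarith⟩).2 k k.lt_succ_self

/-- Every neighborhood of a point of the Sorgenfrey line contains all the points whose expansion
first departs from that of the given point at some fixed place, with a larger term. -/
theorem exists_expansion_preimage_subset {s : SorgenfreyLine} {U : Set SorgenfreyLine}
    (hU : U ∈ 𝓝 s) :
    ∃ n, ∀ t, (∀ i < n, expansion t i = expansion s i) → expansion s n < expansion t n → t ∈ U := by
  obtain ⟨x, rfl⟩ := ofReal.surjective s
  obtain ⟨b, hb, hbU⟩ := mem_nhds_ofReal.1 hU
  obtain ⟨n, hn⟩ := exists_pow_lt_of_lt_one (sub_pos.2 hb) (by norm_num : (1 / 2 : ℝ) < 1)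
  -- The shift by one accounts for term `0`, which codes the integer part.
  refine ⟨n + 1, fun t ht hlt => ?_⟩
  obtain ⟨y, rfl⟩ := ofReal.surjective t
  have h0 : ⌊y⌋ = ⌊x⌋ := Equiv.intEquivNat.injective (ht 0 n.succ_pos)
  have h1 : ∀ i < n, gaps (1 - Int.fract x) i = gaps (1 - Int.fract y) i := fun i hi =>
    (ht (i + 1) (Nat.succ_lt_succ hi)).symm
  have h2 := lt_of_gaps_lt (one_sub_fract_mem x) (one_sub_fract_mem y) h1 hlt
  have h3 := (abs_le.1 (abs_sub_le_of_gaps_eq (one_sub_fract_mem x) (one_sub_fract_mem y) h1)).2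
  have hf : Int.fract y = Int.fract x + (y - x) := by rw [Int.fract, Int.fract, h0]; ring
  exact hbU (show y ∈ Ico x b from ⟨by linarith, by linarith⟩)

end SorgenfreyLine

/-! ### Necessity: continuous images of the Sorgenfrey line -/

namespace SorgenfreyLine

/-- Dyadic approximations from the right. -/
theorem tendsto_floor_add_one_div (x : ℝ) :
    Tendsto (fun n : ℕ => ((⌊2 ^ n * x⌋ : ℝ) + 1) / 2 ^ n) atTop (𝓝[≥] x) := by
  have hle : ∀ n : ℕ, x ≤ ((⌊2 ^ n * x⌋ : ℝ) + 1) / 2 ^ n := fun n => by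
    rw [le_div_iff₀ (by positivity), mul_comm]
    exact (Int.lt_floor_add_one _).le
  refine tendsto_nhdsWithin_iff.2 ⟨?_, .of_forall hle⟩
  refine tendsto_of_tendsto_of_tendsto_of_le_of_le (h := fun n : ℕ => x + (1 / 2) ^ n)
    tendsto_const_nhds ?_ hle fun n => ?_
  · simpa using (tendsto_const_nhds (x := x)).add
      (tendsto_pow_atTop_nhds_zero_of_lt_one (by norm_num) (by norm_num : (1 / 2 : ℝ) < 1))
  · show ((⌊2 ^ n * x⌋ : ℝ) + 1) / 2 ^ n ≤ x + (1 / 2) ^ n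
    rw [div_le_iff₀ (by positivity), add_mul, one_div_pow, one_div_mul_cancel (by positivity)]
    linarith [Int.floor_le (2 ^ n * x)]

variable {Y : Type u} [TopologicalSpace Y]

theorem tendsto_comp_floor {f : SorgenfreyLine → Y} (hf : Continuous f) (x : ℝ) :
    Tendsto (fun n : ℕ => f (ofReal (((⌊2 ^ n * x⌋ : ℝ) + 1) / 2 ^ n))) atTop
      (𝓝 (f (ofReal x))) :=
  (continuous_iff.1 hf x).tendsto.comp (tendsto_floor_add_one_div x)

/-- Right continuity makes the map a pointwise limit of dyadic step functions, each of which factors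
through `ℤ`. -/
theorem measurable_comp_ofReal [TopologicalSpace.PseudoMetrizableSpace Y] [MeasurableSpace Y]
    [BorelSpace Y] {f : SorgenfreyLine → Y} (hf : Continuous f) : Measurable (f ∘ ofReal) := by
  refine measurable_of_tendsto_metrizable (f := fun (n : ℕ) x =>
    f (ofReal (((⌊2 ^ n * x⌋ : ℝ) + 1) / 2 ^ n))) (fun n => ?_)
    (tendsto_pi_nhds.2 fun x => tendsto_comp_floor hf x)
  have h : Measurable fun x : ℝ => ⌊2 ^ n * x⌋ := (measurable_const_mul _).floor
  exact (measurable_from_top (f := fun k : ℤ => f (ofReal (((k : ℝ) + 1) / 2 ^ n)))).comp h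

theorem separableSpace_of_surjective {f : SorgenfreyLine → Y} (hf : Continuous f)
    (hs : Surjective f) : TopologicalSpace.SeparableSpace Y := by
  refine ⟨range fun p : ℤ × ℕ => f (ofReal (((p.1 : ℝ) + 1) / 2 ^ p.2)), countable_range _, ?_⟩
  intro y
  obtain ⟨s, rfl⟩ := hs y
  obtain ⟨x, rfl⟩ := ofReal.surjective s
  exact mem_closure_of_tendsto (tendsto_comp_floor hf x) (.of_forall fun n => ⟨(_, n), rfl⟩)

end SorgenfreyLine

theorem exists_isEmbedding_polishSpace (Y : Type u) [TopologicalSpace Y]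
    [TopologicalSpace.MetrizableSpace Y] [TopologicalSpace.SeparableSpace Y] :
    ∃ (P : Type u) (_ : TopologicalSpace P) (_ : PolishSpace P) (e : Y → P), IsEmbedding e := by
  let _ := TopologicalSpace.metrizableSpaceMetric Y
  have : SecondCountableTopology (UniformSpace.Completion Y) :=
    UniformSpace.secondCountable_of_separable _
  exact ⟨UniformSpace.Completion Y, inferInstance, inferInstance, (↑),
    UniformSpace.Completion.isUniformEmbedding_coe Y |>.isEmbedding⟩

/-- The preimage of a nonempty open set contains some `[x, b)`, and injectivity carries
uncountability over. -/
theorem not_countable_of_continuous_bijective {Y : Type u} [TopologicalSpace Y]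
    {f : SorgenfreyLine → Y} (hf : Continuous f) (hb : Bijective f) {U : Set Y} (hU : IsOpen U) (hne : U.Nonempty) : ¬ U.Countable := by
  intro hc
  obtain ⟨y, hy⟩ := hne
  obtain ⟨s, rfl⟩ := hb.2 y
  obtain ⟨x, rfl⟩ := SorgenfreyLine.ofReal.surjective s
  obtain ⟨b, hxb, hsub⟩ := SorgenfreyLine.mem_nhds_ofReal.1
    (hf.continuousAt.preimage_mem_nhds (hU.mem_nhds hy))
  have hc' : (Ico x b).Countable := by
    refine Countable.mono hsub ?_
    exact (hc.preimage_of_injOn hb.1.injOn).preimage_of_injOn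
      SorgenfreyLine.ofReal.injective.injOn
  exact Cardinal.Real.Ico_countable_iff.not.2 (not_le.2 hxb) hc'

variable {Y : Type u} [TopologicalSpace Y] [TopologicalSpace.MetrizableSpace Y]

theorem isAnalyticSpace_of_continuous_surjective {f : SorgenfreyLine → Y} (hf : Continuous f)
    (hs : Surjective f) : IsAnalyticSpace Y := by
  have := SorgenfreyLine.separableSpace_of_surjective hf hs
  obtain ⟨P, _, _, e, he⟩ := exists_isEmbedding_polishSpace Y
  refine ⟨P, inferInstance, inferInstance, range e, ?_, ⟨he.toHomeomorph⟩⟩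
  borelize P
  have hm := SorgenfreyLine.measurable_comp_ofReal (he.continuous.comp hf)
  have h := MeasurableSet.univ.analyticSet_image hm
  rwa [image_univ, SorgenfreyLine.ofReal.surjective.range_comp, hs.range_comp] at h

/-- By Lusin–Souslin, an injective Borel map from `ℝ` into a Polish space has Borel range. -/
theorem isAbsoluteBorelSpace_of_continuous_bijective {f : SorgenfreyLine → Y} (hf : Continuous f)
    (hb : Bijective f) : IsAbsoluteBorelSpace Y := by
  have := SorgenfreyLine.separableSpace_of_surjective hf hb.2
  obtain ⟨P, _, _, e, he⟩ := exists_isEmbedding_polishSpace Y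
  refine ⟨P, inferInstance, inferInstance, range e, ?_, ⟨he.toHomeomorph⟩⟩
  borelize P
  have hm := SorgenfreyLine.measurable_comp_ofReal (he.continuous.comp hf)
  have h := (hm.measurableEmbedding
    ((he.injective.comp hb.1).comp SorgenfreyLine.ofReal.injective)).measurableSet_range
  rwa [SorgenfreyLine.ofReal.surjective.range_comp, hb.2.range_comp] at h

/-! ### Almost open maps -/

/-- A map is almost open if each point of the codomain has a preimage at which the map is open. -/
def IsAlmostOpenMap {X : Type u} {Y : Type v} [TopologicalSpace X] [TopologicalSpace Y]
    (f : X → Y) : Prop :=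
  ∀ y, ∃ x, f x = y ∧ ∀ U ∈ 𝓝 x, f '' U ∈ 𝓝 y

namespace IsAlmostOpenMap

variable {X : Type u} {Y : Type v} [TopologicalSpace X] [TopologicalSpace Y] {f : X → Y}

theorem surjective (hf : IsAlmostOpenMap f) : Surjective f := fun y => (hf y).imp fun _ h => h.1

theorem isBiquotientMap (hf : IsAlmostOpenMap f) : IsBiquotientMap f where
  surjective := hf.surjective
  exists_finite_mem_interior y 𝒰 h𝒰 hcov := by
    obtain ⟨x, hx, hopen⟩ := hf y
    obtain ⟨U, hU, hxU⟩ := hcov hx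
    refine ⟨{U}, singleton_subset_iff.2 hU, finite_singleton U, ?_⟩
    rw [biUnion_singleton, mem_interior_iff_mem_nhds]
    exact hopen U ((h𝒰 U hU).mem_nhds hxU)

theorem isPseudoOpenMap (hf : IsAlmostOpenMap f) : IsPseudoOpenMap f where
  surjective := hf.surjective
  mem_interior_image y U hU hfib := by
    obtain ⟨x, hx, hopen⟩ := hf y
    exact mem_interior_iff_mem_nhds.2 (hopen U (hU.mem_nhds (hfib hx)))

theorem isQuotientMap (hf : IsAlmostOpenMap f) (hc : Continuous f) : IsQuotientMap f := by
  refine ⟨.of_isOpen_preimage_iff_isOpen fun s => ⟨fun h => ?_, fun h => h.preimage hc⟩,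
    hf.surjective⟩
  refine isOpen_iff_mem_nhds.2 fun y hy => ?_
  obtain ⟨x, rfl, hopen⟩ := hf y
  exact mem_of_superset (hopen _ (h.mem_nhds hy)) (image_preimage_subset f s)

end IsAlmostOpenMap

/-! ### Analytic spaces -/
theorem IsAnalyticSpace.exists_continuous_surjective {Y : Type u} [TopologicalSpace Y] [Nonempty Y]
    (hY : IsAnalyticSpace Y) : ∃ f : (ℕ → ℕ) → Y, Continuous f ∧ Surjective f := by
  obtain ⟨P, _, _, s, hs, ⟨e⟩⟩ := hY
  rw [MeasureTheory.AnalyticSet] at hs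
  rcases hs with rfl | ⟨f, hf, rfl⟩
  · exact (e (Classical.arbitrary Y)).2.elim
  · exact ⟨fun z => e.symm ⟨f z, mem_range_self z⟩,
      e.symm.continuous.comp (hf.subtype_mk _), fun y => by
        obtain ⟨z, hz⟩ := (e y).2
        exact ⟨z, by simp [hz]⟩⟩

/-- An open nonempty subset of a continuous image of the Baire space is again such an image. -/
theorem IsOpen.exists_continuous_range_eq {Y : Type u} [TopologicalSpace Y] {f : (ℕ → ℕ) → Y}
    (hf : Continuous f) (hs : Surjective f) {M : Set Y} (hM : IsOpen M) (hne : M.Nonempty) :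
    ∃ m : (ℕ → ℕ) → Y, Continuous m ∧ range m = M := by
  have h := (hM.preimage hf).analyticSet_image (f := id) continuous_id
  rw [image_id, MeasureTheory.AnalyticSet] at h
  rcases h with h | ⟨g, hg, hr⟩
  · exact absurd h (hne.preimage hs).ne_empty
  · exact ⟨f ∘ g, hf.comp hg, by rw [range_comp, hr, image_preimage_eq M hs]⟩

/-! ### Gluing continuous maps along a first index -/

section FirstIndex

variable {α : Type*} {Y : Type v} (p : α → Prop)

/-- Gluing along the first index `n` at which the sequence `z` satisfies `p`: the value at `z` is
`G n z` if there is such an index, and `d z` otherwise. -/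
noncomputable def firstIndexGlue (d : (ℕ → α) → Y) (G : ℕ → (ℕ → α) → Y) (z : ℕ → α) : Y :=
  open Classical in if h : ∃ n, p (z n) then G (Nat.find h) z else d z

variable {p} {d : (ℕ → α) → Y} {G : ℕ → (ℕ → α) → Y}

theorem firstIndexGlue_of_forall {z : ℕ → α} (h : ∀ n, ¬ p (z n)) :
    firstIndexGlue p d G z = d z := dif_neg (not_exists.2 h)

theorem firstIndexGlue_of_first {z : ℕ → α} {n : ℕ} (hn : p (z n)) (h : ∀ i < n, ¬ p (z i)) :
    firstIndexGlue p d G z = G n z := by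
  classical
  have he : ∃ n, p (z n) := ⟨n, hn⟩
  have : Nat.find he = n := (Nat.find_eq_iff he).2 ⟨hn, h⟩
  rw [firstIndexGlue, dif_pos he]
  convert rfl
  exact this.symm

theorem exists_first_index {z : ℕ → α} (h : ¬ ∀ n, ¬ p (z n)) :
    ∃ n, p (z n) ∧ ∀ i < n, ¬ p (z i) := by
  classical
  push Not at h
  exact ⟨Nat.find h, Nat.find_spec h, fun i hi => Nat.find_min h hi⟩

/-- If `z` has a first index `n`, the glued map is `G n` on the cylinder of length `n + 1`. Only
sequences without an index need `hd`: the index of a nearby sequence is large, so `G n` must tend to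
`d z` there. -/
theorem continuous_firstIndexGlue [TopologicalSpace α] [DiscreteTopology α] [TopologicalSpace Y]
    (hG : ∀ n, Continuous (G n))
    (hd : ∀ z, (∀ n, ¬ p (z n)) → ∀ U ∈ 𝓝 (d z), ∃ k, ∀ w ∈ PiNat.cylinder z k,
      ((∀ n, ¬ p (w n)) → d w ∈ U) ∧
      ∀ n ≥ k, p (w n) → (∀ i < n, ¬ p (w i)) → G n w ∈ U) :
    Continuous (firstIndexGlue p d G) := by
  refine continuous_iff_continuousAt.2 fun z => ?_
  by_cases hz : ∀ n, ¬ p (z n)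
  · rw [ContinuousAt, firstIndexGlue_of_forall hz]
    intro U hU
    obtain ⟨k, hk⟩ := hd z hz U hU
    refine mem_map.2 (mem_of_superset (cylinder_mem_nhds z k) fun w hw => ?_)
    rw [mem_preimage]
    by_cases hwp : ∀ n, ¬ p (w n)
    · rw [firstIndexGlue_of_forall hwp]
      exact (hk w hw).1 hwp
    · obtain ⟨n, hn, hlt⟩ := exists_first_index hwp
      rw [firstIndexGlue_of_first hn hlt]
      refine (hk w hw).2 n ?_ hn hlt
      by_contra! hnk
      rw [hw n hnk] at hn
      exact hz n hn
  · obtain ⟨n, hn, hlt⟩ := exists_first_index hz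
    refine (hG n).continuousAt.congr ?_
    filter_upwards [cylinder_mem_nhds z (n + 1)] with w hw
    rw [firstIndexGlue_of_first (by rwa [hw n n.lt_succ_self])
      fun i hi => by rw [hw i (hi.trans n.lt_succ_self)]; exact hlt i hi]

end FirstIndex

/-- Serves maps with parameters that depend on the first `n` terms only: `F z` freezes these
parameters at `z`. -/
theorem continuous_of_eqOn_cylinder {α Y : Type*} [TopologicalSpace α] [DiscreteTopology α]
    [TopologicalSpace Y] {f : (ℕ → α) → Y} (n : ℕ) (F : (ℕ → α) → (ℕ → α) → Y)
    (hF : ∀ z, Continuous (F z)) (h : ∀ z, ∀ w ∈ PiNat.cylinder z n, f w = F z w) :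
    Continuous f :=
  continuous_iff_continuousAt.2 fun z => (hF z).continuousAt.congr <| by
    filter_upwards [cylinder_mem_nhds z n] with w hw using (h z w hw).symm

theorem continuous_tail {α : Type*} [TopologicalSpace α] (n : ℕ) :
    Continuous fun (z : ℕ → α) k => z (n + k) :=
  continuous_pi fun k => continuous_apply (n + k)

/-! ### Almost open maps onto analytic spaces -/

/-- Every metrizable nonempty analytic space is an image of the Sorgenfrey line under a continuous
map that is almost open. -/
theorem exists_continuous_isAlmostOpenMap {Y : Type u} [TopologicalSpace Y]
    [TopologicalSpace.MetrizableSpace Y] [Nonempty Y] (hY : IsAnalyticSpace Y) :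
    ∃ f : SorgenfreyLine → Y, Continuous f ∧ IsAlmostOpenMap f := by
  let _ := TopologicalSpace.metrizableSpaceMetric Y
  obtain ⟨ψ, hψ, hsurj⟩ := hY.exists_continuous_surjective
  set half : (ℕ → ℕ) → (ℕ → ℕ) := fun z k => z k / 2 with hhalf
  -- `M n u` is an open neighborhood of `ψ u` that depends on the first `n` terms of `u` only and
  -- shrinks to `ψ u` as `n` grows.
  set M : ℕ → (ℕ → ℕ) → Set Y := fun n u =>
    Metric.thickening ((1 / 2 : ℝ) ^ n) (ψ '' PiNat.cylinder u n) with hM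
  have hpos : ∀ n : ℕ, (0 : ℝ) < (1 / 2) ^ n := fun n => by positivity
  have hMmem : ∀ n u, ψ u ∈ M n u := fun n u => Metric.self_subset_thickening (hpos n) _
    (mem_image_of_mem _ (PiNat.self_mem_cylinder u n))
  have hMo : ∀ n u, IsOpen (M n u) := fun n u => Metric.isOpen_thickening
  have hMcyl : ∀ n u, ∀ v ∈ PiNat.cylinder u n, M n v = M n u := fun n u v hv => by
    rw [hM]; simp only [PiNat.mem_cylinder_iff_eq.1 hv]
  -- Choosing the parametrization per set, not per pair `(n, u)`, makes it the same for all `u` in a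
  -- cylinder; `ψ` is a dummy value for the other sets.
  have hex : ∀ S : Set Y, ∃ m : (ℕ → ℕ) → Y,
      IsOpen S → S.Nonempty → Continuous m ∧ range m = S := fun S => by
    by_cases hS : IsOpen S ∧ S.Nonempty
    · obtain ⟨m, hm⟩ := IsOpen.exists_continuous_range_eq hψ hsurj hS.1 hS.2
      exact ⟨m, fun _ _ => hm⟩
    · exact ⟨ψ, fun h1 h2 => absurd ⟨h1, h2⟩ hS⟩
  choose m hm using hex
  have hmc : ∀ n u, Continuous (m (M n u)) := fun n u => (hm _ (hMo n u) ⟨_, hMmem n u⟩).1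
  have hmr : ∀ n u, range (m (M n u)) = M n u := fun n u => (hm _ (hMo n u) ⟨_, hMmem n u⟩).2
  have hcyl : ∀ {z w : ℕ → ℕ} {n : ℕ}, w ∈ PiNat.cylinder z n →
      half w ∈ PiNat.cylinder (half z) n := fun {z w n} h i hi => by
    rw [hhalf]; simp only [h i hi]
  -- When the first odd term stands at `n`, the terms after it parametrize the whole of `M n (half
  -- z)`.
  set G : ℕ → (ℕ → ℕ) → Y := fun n z => m (M n (half z)) fun k => z (n + 1 + k) with hG
  set f : (ℕ → ℕ) → Y := firstIndexGlue Odd (ψ ∘ half) G with hf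
  have hfc : Continuous f := by
    refine continuous_firstIndexGlue (fun n => ?_) fun z hz U hU => ?_
    · refine continuous_of_eqOn_cylinder n (fun z w => m (M n (half z)) fun k => w (n + 1 + k))
        (fun z => (hmc n _).comp (continuous_tail (n + 1))) fun z w hw => ?_
      rw [hG]
      simp only [hMcyl n _ _ (hcyl hw)]
    · obtain ⟨ε, hε, hball⟩ := Metric.mem_nhds_iff.1 hU
      obtain ⟨k₁, -, hk₁⟩ := exists_cylinder_subset
        (hψ.continuousAt.preimage_mem_nhds (Metric.ball_mem_nhds (ψ (half z)) (half_pos hε))) 0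
      obtain ⟨k₂, hk₂⟩ := exists_pow_lt_of_lt_one (half_pos hε) (by norm_num : (1 / 2 : ℝ) < 1)
      refine ⟨max k₁ k₂, fun w hw => ⟨fun _ => hball ?_, fun n hn _ _ => hball ?_⟩⟩
      · exact Metric.ball_subset_ball (half_le_self hε.le)
          (hk₁ (PiNat.cylinder_anti _ (le_max_left _ _) (hcyl hw)))
      · have hmem : G n w ∈ M n (half w) := by
          rw [← hmr n (half w)]
          exact mem_range_self _
        obtain ⟨_, ⟨v, hv, rfl⟩, hdist⟩ := Metric.mem_thickening_iff.1 hmem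
        have hv' : v ∈ PiNat.cylinder (half z) k₁ := by
          have h1 := PiNat.cylinder_anti (half w) hn hv
          rw [PiNat.mem_cylinder_iff_eq.1 (hcyl hw)] at h1
          exact PiNat.cylinder_anti _ (le_max_left _ _) h1
        have h2 : dist (ψ v) (ψ (half z)) < ε / 2 := hk₁ hv'
        have h3 : ((1 : ℝ) / 2) ^ n ≤ (1 / 2) ^ k₂ :=
          pow_le_pow_of_le_one (by norm_num) (by norm_num) ((le_max_right _ _).trans hn)
        rw [Metric.mem_ball, comp_apply]
        linarith [dist_triangle (G n w) (ψ v) (ψ (half z))]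
  refine ⟨f ∘ SorgenfreyLine.expansion, hfc.comp SorgenfreyLine.continuous_expansion, fun y => ?_⟩
  obtain ⟨u, rfl⟩ := hsurj y
  obtain ⟨s, hs⟩ := SorgenfreyLine.expansion_surjective fun k => 2 * u k
  have hodd : ∀ k, ¬ Odd (2 * u k) := fun k => by simp
  have hhu : half (fun k => 2 * u k) = u := by
    funext k
    simp [hhalf]
  refine ⟨s, ?_, fun U hU => ?_⟩
  · rw [comp_apply, hs, hf, firstIndexGlue_of_forall hodd, comp_apply, hhu]
  · obtain ⟨n, hn⟩ := SorgenfreyLine.exists_expansion_preimage_subset hU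
    refine mem_of_superset ((hMo n u).mem_nhds (hMmem n u)) fun y' hy' => ?_
    rw [← hmr n u] at hy'
    obtain ⟨v, rfl⟩ := hy'
    -- The term `2 * u n + 1` exceeds `2 * u n`, which puts the point into `U`, and is the first odd
    -- term, which leaves the tail `v` free to reach any point of `M n u`.
    set w : ℕ → ℕ := seqAppend (fun k => 2 * u k) n (seqCons (2 * u n + 1) v) with hw
    have hwlt : ∀ i < n, w i = 2 * u i := fun i hi => seqAppend_of_lt hi
    have hwn : w n = 2 * u n + 1 := seqAppend_add _ n _ 0
    obtain ⟨t, ht⟩ := SorgenfreyLine.expansion_surjective w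
    refine ⟨t, hn t (fun i hi => by rw [ht, hs, hwlt i hi]) (by rw [ht, hs, hwn]; simp), ?_⟩
    rw [comp_apply, ht, hf, firstIndexGlue_of_first (by rw [hwn]; exact odd_two_mul_add_one _)
      fun i hi => by rw [hwlt i hi]; exact hodd i]
    have h1 : M n (half w) = M n u := by
      refine hMcyl n u _ fun i hi => ?_
      rw [← hhu]
      simp only [hhalf, hwlt i hi]
    have h2 : (fun k => w (n + 1 + k)) = v := by
      funext k
      rw [hw, add_assoc, seqAppend_add, add_comm 1 k, seqCons_succ]
    rw [hG]
    simp only [h1, h2]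

/-! ### Injective continuous images of the Baire space -/

/-- A set is an injective Baire image if it is the range of a continuous injection of `ℕ → ℕ`. -/
def IsInjectiveBaireImage {Y : Type*} [TopologicalSpace Y] (A : Set Y) : Prop :=
  ∃ f : (ℕ → ℕ) → Y, Continuous f ∧ Injective f ∧ range f = A

namespace IsInjectiveBaireImage

variable {Y Z : Type*} [TopologicalSpace Y] [TopologicalSpace Z]

theorem image {A : Set Y} (hA : IsInjectiveBaireImage A) {g : Y → Z} (hg : Continuous g)
    (hi : Injective g) : IsInjectiveBaireImage (g '' A) := by
  obtain ⟨f, hf, hfi, rfl⟩ := hA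
  exact ⟨g ∘ f, hg.comp hf, hi.comp hfi, range_comp g f⟩

/-- The term `z 0` codes both the piece and the first term of the parameter in it. Coding the pair
also covers finite `J`. -/
theorem iUnion {J : Type*} [Countable J] [Nonempty J] {A : J → Set Y}
    (hA : ∀ j, IsInjectiveBaireImage (A j)) (hd : Pairwise (Disjoint on A)) :
    IsInjectiveBaireImage (⋃ j, A j) := by
  choose f hf hfi hfr using hA
  have hmem : ∀ j z, f j z ∈ A j := fun j z => hfr j ▸ mem_range_self z
  obtain ⟨e⟩ := nonempty_equiv_of_countable (α := ℕ) (β := J × ℕ)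
  refine ⟨fun z => f (e (z 0)).1 (seqCons (e (z 0)).2 fun k => z (1 + k)), ?_, ?_, ?_⟩
  · refine continuous_of_eqOn_cylinder 1
      (fun z w => f (e (z 0)).1 (seqCons (e (z 0)).2 fun k => w (1 + k)))
      (fun z => (hf _).comp ((continuous_seqCons _).comp (continuous_tail 1))) fun z w hw => ?_
    simp only [hw 0 one_pos]
  · intro z w h
    have h1 : (e (z 0)).1 = (e (w 0)).1 := by
      by_contra hne
      simp only at h
      have h2 := hmem (e (z 0)).1 (seqCons (e (z 0)).2 fun k => z (1 + k))
      exact disjoint_left.1 (hd hne) h2 (by rw [h]; exact hmem _ _)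
    simp only [h1] at h
    have h2 := hfi _ h
    have h3 : (e (z 0)).2 = (e (w 0)).2 := congrFun h2 0
    have h4 : z 0 = w 0 := e.injective (Prod.ext h1 h3)
    funext k
    cases k with
    | zero => exact h4
    | succ k => simpa [add_comm] using congrFun h2 (k + 1)
  · refine subset_antisymm (range_subset_iff.2 fun z => mem_iUnion_of_mem _ (hmem _ _)) ?_
    refine iUnion_subset fun j y hy => ?_
    rw [← hfr j] at hy
    obtain ⟨w, rfl⟩ := hy
    refine ⟨seqCons (e.symm (j, w 0)) fun k => w (k + 1), ?_⟩
    simp only [seqCons_zero, Equiv.apply_symm_apply, add_comm 1, seqCons_succ, seqCons_head_tail]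

/-- A point may be added to a disjoint sequence of sets that converges to it. -/
theorem insert_iUnion {A : ℕ → Set Y} (hA : ∀ n, IsInjectiveBaireImage (A n))
    (hd : Pairwise (Disjoint on A)) {c : Y} (hc : ∀ n, c ∉ A n)
    (hlim : ∀ U ∈ 𝓝 c, ∀ᶠ n in atTop, A n ⊆ U) :
    IsInjectiveBaireImage (insert c (⋃ n, A n)) := by
  choose f hf hfi hfr using hA
  have hmem : ∀ j z, f j z ∈ A j := fun j z => hfr j ▸ mem_range_self z
  -- The number of leading zeros selects the set `A n`, and the zero sequence goes to `c`. The first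
  -- nonzero term is a term of the parameter raised by one, hence `z n - 1`.
  set G : ℕ → (ℕ → ℕ) → Y := fun n z => f n (seqCons (z n - 1) fun k => z (n + 1 + k)) with hG
  have hGmem : ∀ n z, G n z ∈ A n := fun n z => hmem _ _
  set F : (ℕ → ℕ) → Y := firstIndexGlue (fun a : ℕ => a ≠ 0) (fun _ => c) G with hF
  have hF0 : ∀ {z : ℕ → ℕ}, (∀ n, z n = 0) → F z = c := fun h =>
    firstIndexGlue_of_forall (p := fun a : ℕ => a ≠ 0) fun n => not_not.2 (h n)
  have hF1 : ∀ {z : ℕ → ℕ} {n : ℕ}, z n ≠ 0 → (∀ i < n, z i = 0) → F z = G n z := fun hn h =>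
    firstIndexGlue_of_first (p := fun a : ℕ => a ≠ 0) hn fun i hi => not_not.2 (h i hi)
  have hex : ∀ {z : ℕ → ℕ}, (¬ ∀ n, z n = 0) → ∃ n, z n ≠ 0 ∧ ∀ i < n, z i = 0 := fun h => by
    simpa using exists_first_index (p := fun a : ℕ => a ≠ 0) (by simpa using h)
  refine ⟨F, ?_, ?_, ?_⟩
  · refine continuous_firstIndexGlue (fun n => ?_) fun z _ U hU => ?_
    · refine continuous_of_eqOn_cylinder (n + 1)
        (fun z w => f n (seqCons (z n - 1) fun k => w (n + 1 + k)))
        (fun z => (hf _).comp ((continuous_seqCons _).comp (continuous_tail _))) fun z w hw => ?_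
      simp only [hG, hw n n.lt_succ_self]
    · obtain ⟨k, hk⟩ := eventually_atTop.1 (hlim U hU)
      exact ⟨k, fun w _ => ⟨fun _ => mem_of_mem_nhds hU, fun n hn _ _ => hk n hn (hGmem n w)⟩⟩
  · intro z w h
    by_cases hz : ∀ n, z n = 0 <;> by_cases hw : ∀ n, w n = 0
    · funext n
      rw [hz n, hw n]
    · obtain ⟨n, hn, hlt⟩ := hex hw
      rw [hF0 hz, hF1 hn hlt] at h
      exact absurd (h ▸ hGmem n w) (hc n)
    · obtain ⟨n, hn, hlt⟩ := hex hz
      rw [hF0 hw, hF1 hn hlt] at h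
      exact absurd (h ▸ hGmem n z) (hc n)
    · obtain ⟨n, hn, hlt⟩ := hex hz
      obtain ⟨n', hn', hlt'⟩ := hex hw
      rw [hF1 hn hlt, hF1 hn' hlt'] at h
      have hnn : n = n' := by
        by_contra hne
        exact disjoint_left.1 (hd hne) (hGmem n z) (h ▸ hGmem n' w)
      subst hnn
      have h2 := hfi _ h
      have h3 : z n - 1 = w n - 1 := congrFun h2 0
      funext k
      rcases lt_trichotomy k n with hk | rfl | hk
      · rw [hlt k hk, hlt' k hk]
      · omega
      · obtain ⟨i, rfl⟩ := Nat.exists_eq_add_of_lt hk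
        simpa [add_right_comm] using congrFun h2 (i + 1)
  · refine subset_antisymm (range_subset_iff.2 fun z => ?_) ?_
    · by_cases hz : ∀ n, z n = 0
      · rw [hF0 hz]
        exact mem_insert _ _
      · obtain ⟨n, hn, hlt⟩ := hex hz
        rw [hF1 hn hlt]
        exact mem_insert_of_mem _ (mem_iUnion_of_mem n (hGmem n z))
    · refine insert_subset ⟨0, hF0 (by simp)⟩ ?_
      refine iUnion_subset fun n y hy => ?_
      rw [← hfr n] at hy
      obtain ⟨w, rfl⟩ := hy
      refine ⟨seqAppend 0 n (seqCons (w 0 + 1) fun k => w (k + 1)), ?_⟩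
      have hn : seqAppend 0 n (seqCons (w 0 + 1) fun k => w (k + 1)) n = w 0 + 1 :=
        seqAppend_add _ n _ 0
      rw [hF1 (by rw [hn]; exact Nat.succ_ne_zero _)
        fun i hi => by rw [seqAppend_of_lt hi]; simp]
      simp only [hG, hn, add_assoc, seqAppend_add, add_comm 1, seqCons_succ, Nat.add_sub_cancel,
        seqCons_head_tail]

end IsInjectiveBaireImage

/-! ### A partition of the product of the Baire space and the Cantor space -/

/-- The strictly increasing sequence with given gaps. -/
def gapSeq (z : ℕ → ℕ) : ℕ → ℕ
  | 0 => z 0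
  | k + 1 => gapSeq z k + z (k + 1) + 1

theorem gapSeq_strictMono (z : ℕ → ℕ) : StrictMono (gapSeq z) :=
  strictMono_nat_of_lt_succ fun k => by rw [gapSeq]; omega

theorem gapSeq_injective : Injective gapSeq := by
  intro z w h
  funext k
  cases k with
  | zero => exact congrFun h 0
  | succ k =>
    have h1 := congrFun h (k + 1)
    rw [gapSeq, gapSeq, congrFun h k] at h1
    omega

theorem exists_gapSeq_eq {a : ℕ → ℕ} (ha : StrictMono a) : ∃ z, gapSeq z = a := by
  refine ⟨fun k => Nat.casesOn k (a 0) fun k => a (k + 1) - a k - 1, ?_⟩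
  funext k
  induction k with
  | zero => rfl
  | succ k ih =>
    rw [gapSeq, ih]
    have : a k < a (k + 1) := ha k.lt_succ_self
    simp only
    omega

theorem gapSeq_congr {z w : ℕ → ℕ} {k : ℕ} (h : ∀ i ≤ k, w i = z i) : gapSeq w k = gapSeq z k := by
  induction k with
  | zero => exact h 0 le_rfl
  | succ k ih => rw [gapSeq, gapSeq, ih fun i hi => h i (hi.trans k.le_succ), h _ le_rfl]

open Classical in
/-- The characteristic function of a set of natural numbers. -/
noncomputable def charFun (A : Set ℕ) (k : ℕ) : Bool := decide (k ∈ A)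

theorem charFun_injective : Injective charFun := fun A B h => by
  ext k
  simpa [charFun] using congrFun h k

theorem charFun_setOf (w : ℕ → Bool) : charFun {k | w k = true} = w := by
  funext k
  simp [charFun]

/-- Since `k ≤ gapSeq z k`, membership of `k` in the range is decided by the terms up to `k`. -/
theorem continuous_charFun_range_gapSeq : Continuous fun z => charFun (range (gapSeq z)) := by
  refine continuous_pi fun k => continuous_of_eqOn_cylinder (k + 1)
    (fun z _ => charFun (range (gapSeq z)) k) (fun z => continuous_const) fun z w hw => ?_
  have key : ∀ {z w : ℕ → ℕ}, w ∈ PiNat.cylinder z (k + 1) → k ∈ range (gapSeq w) →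
      k ∈ range (gapSeq z) := by
    rintro z w hw ⟨i, hi⟩
    have hik : i ≤ k := hi ▸ (gapSeq_strictMono w).id_le i
    exact ⟨i, by rw [← hi]; exact (gapSeq_congr fun j hj => hw j (by omega)).symm⟩
  have : k ∈ range (gapSeq w) ↔ k ∈ range (gapSeq z) :=
    ⟨key hw, key ((PiNat.mem_cylinder_comm _ _ _).1 hw)⟩
  simp [charFun, this]

/-- The pieces of the partition: one is the set of the pairs whose second entry codes an infinite
set; the others are products of a cylinder and a point that codes a finite set. -/
def baireCantorPiece :
    Option (Σ A : Finset ℕ, Fin A.card → ℕ) → Set ((ℕ → ℕ) × (ℕ → Bool))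
  | none => {p | {k | p.2 k = true}.Infinite}
  | some ⟨A, σ⟩ => {p | (∀ i : Fin A.card, p.1 i = σ i) ∧ p.2 = charFun A}

/-- Infinite subsets of `ℕ` correspond to their increasing enumerations, hence to gap sequences, and
two sequences interleave into one. Each other piece is a cylinder times a point. -/
theorem isInjectiveBaireImage_baireCantorPiece (i : Option (Σ A : Finset ℕ, Fin A.card → ℕ)) :
    IsInjectiveBaireImage (baireCantorPiece i) := by
  rcases i with _ | ⟨A, σ⟩
  · refine ⟨fun z => (fun k => z (2 * k), charFun (range (gapSeq fun k => z (2 * k + 1)))), ?_, ?_, ?_⟩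
    · exact (continuous_pi fun k => continuous_apply (2 * k)).prodMk
        (continuous_charFun_range_gapSeq.comp (continuous_pi fun k => continuous_apply (2 * k + 1)))
    · intro z w h
      obtain ⟨h1, h2⟩ := Prod.mk.inj h
      have h3 := gapSeq_injective (((gapSeq_strictMono _).range_inj (gapSeq_strictMono _)).1
        (charFun_injective h2))
      funext k
      obtain ⟨m, rfl | rfl⟩ := Nat.even_or_odd' k
      · exact congrFun h1 m
      · exact congrFun h3 m
    · refine subset_antisymm (range_subset_iff.2 fun z => ?_) fun p hp => ?_
      · have : {k | charFun (range (gapSeq fun k => z (2 * k + 1))) k = true}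
            = range (gapSeq fun k => z (2 * k + 1)) := by ext k; simp [charFun]
        rw [baireCantorPiece, mem_ofPred_eq, this]
        exact infinite_range_of_injective (gapSeq_strictMono _).injective
      · have hp' : {k | p.2 k = true}.Infinite := hp
        obtain ⟨w, hw⟩ := exists_gapSeq_eq (Nat.nth_strictMono hp')
        refine ⟨fun k => if Even k then p.1 (k / 2) else w (k / 2), Prod.ext ?_ ?_⟩
        · funext k
          simp
        · have h1 : (fun k => if Even (2 * k + 1) then p.1 ((2 * k + 1) / 2)
              else w ((2 * k + 1) / 2)) = w := by
            funext k
            have : (2 * k + 1) / 2 = k := by omega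
            simp [this]
          simp only [h1, hw, Nat.range_nth_of_infinite hp', charFun_setOf]
  · set x : ℕ → ℕ := fun i => if h : i < A.card then σ ⟨i, h⟩ else 0 with hx
    have hxi : ∀ i : Fin A.card, x i = σ i := fun i => by simp [hx]
    refine ⟨fun z => (seqAppend x A.card z, charFun A), ?_, ?_, ?_⟩
    · exact (continuous_seqAppend x A.card).prodMk continuous_const
    · intro z w h
      funext k
      have := congrFun (Prod.mk.inj h).1 (A.card + k)
      simpa using this
    · refine subset_antisymm (range_subset_iff.2 fun z => ⟨fun i => ?_, rfl⟩) ?_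
      · show seqAppend x A.card z i = σ i
        rw [seqAppend_of_lt i.2, hxi]
      · rintro ⟨y, w⟩ ⟨h1, h2⟩
        refine ⟨fun k => y (A.card + k), Prod.ext ?_ h2.symm⟩
        exact seqAppend_tail fun i hi => (h1 ⟨i, hi⟩).trans (hxi ⟨i, hi⟩).symm

theorem pairwise_disjoint_baireCantorPiece : Pairwise (Disjoint on baireCantorPiece) := by
  have hfin : ∀ {A : Finset ℕ} {w : ℕ → Bool}, w = charFun A → {k | w k = true}.Finite := by
    rintro A _ rfl
    exact A.finite_toSet.subset fun k hk => by simpa [charFun] using hk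
  intro i j hij
  refine disjoint_left.2 fun p hi hj => hij ?_
  rcases i with _ | ⟨A, σ⟩ <;> rcases j with _ | ⟨B, τ⟩
  · rfl
  · exact absurd (hfin hj.2) hi
  · exact absurd (hfin hi.2) hj
  · obtain rfl : A = B := Finset.coe_injective (charFun_injective (hi.2.symm.trans hj.2))
    obtain rfl : σ = τ := funext fun i => (hi.1 i).symm.trans (hj.1 i)
    rfl

theorem iUnion_baireCantorPiece : ⋃ i, baireCantorPiece i = univ := by
  refine eq_univ_of_forall fun p => mem_iUnion.2 ?_
  by_cases hp : {k | p.2 k = true}.Infinite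
  · exact ⟨none, hp⟩
  · rw [not_infinite] at hp
    exact ⟨some ⟨hp.toFinset, fun i => p.1 i⟩, fun i => rfl, by
      rw [Finite.coe_toFinset, charFun_setOf]⟩

/-- The cylinder over a finite set `A` has length `A.card`, so a large `A` makes the piece small in
the first factor, while prescribing `A` below `k` controls the second. -/
theorem infinite_baireCantorPiece_subset {V : Set ((ℕ → ℕ) × (ℕ → Bool))} (hV : IsOpen V)
    (hne : V.Nonempty) : {i | baireCantorPiece i ⊆ V}.Infinite := by
  obtain ⟨⟨x, w⟩, hxw⟩ := hne
  obtain ⟨U₁, hU₁, U₂, hU₂, hU⟩ := mem_nhds_prod_iff.1 (hV.mem_nhds hxw)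
  obtain ⟨N, -, hN⟩ := exists_cylinder_subset hU₁ 0
  obtain ⟨k, -, hk⟩ := exists_cylinder_subset hU₂ 0
  -- Below `k` the set copies `w`; the interval above gives it at least `N` elements and distinct
  -- cardinalities for distinct `j`.
  set A : ℕ → Finset ℕ := fun j =>
    (Finset.range k).filter (fun i => w i = true) ∪ Finset.Ico k (k + N + j) with hA
  have hcard : ∀ j, (A j).card = ((Finset.range k).filter (fun i => w i = true)).card + (N + j) := by
    intro j
    rw [hA]
    simp only
    rw [Finset.card_union_of_disjoint, Nat.card_Ico]
    · omega
    · refine Finset.disjoint_left.2 fun i hi hi' => ?_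
      simp only [Finset.mem_filter, Finset.mem_range, Finset.mem_Ico] at hi hi'
      omega
  refine infinite_of_injective_forall_mem
    (f := fun j : ℕ => some ⟨A j, fun i => x i⟩) (fun i j hij => ?_) fun j => ?_
  · have h : A i = A j := congrArg Sigma.fst (Option.some.inj hij)
    have := congrArg Finset.card h
    rw [hcard, hcard] at this
    omega
  · rintro ⟨y, v⟩ ⟨h1, h2⟩
    refine hU ⟨hN fun i hi => h1 ⟨i, ?_⟩, hk fun i hi => ?_⟩
    · rw [hcard]; omega
    · have h2' : v = charFun (A j) := h2
      show v i = w i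
      rw [h2', Bool.eq_iff_iff]
      simp [charFun, hA, hi]

/-- The product of the Baire space and the Cantor space has a partition into a sequence of
injective Baire images such that every nonempty open set contains infinitely many of them. -/
theorem exists_partition_baireCantor :
    ∃ T : ℕ → Set ((ℕ → ℕ) × (ℕ → Bool)), (∀ i, IsInjectiveBaireImage (T i)) ∧
      Pairwise (Disjoint on T) ∧ ⋃ i, T i = univ ∧
      ∀ V, IsOpen V → V.Nonempty → {i | T i ⊆ V}.Infinite := by
  have : Infinite (Option (Σ A : Finset ℕ, Fin A.card → ℕ)) :=
    infinite_univ_iff.1 ((infinite_baireCantorPiece_subset isOpen_univ univ_nonempty).mono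
      (subset_univ _))
  obtain ⟨e⟩ := nonempty_equiv_of_countable (α := ℕ) (β := Option (Σ A : Finset ℕ, Fin A.card → ℕ))
  refine ⟨baireCantorPiece ∘ e, fun i => isInjectiveBaireImage_baireCantorPiece _,
    fun i j hij => pairwise_disjoint_baireCantorPiece (e.injective.ne hij), ?_, fun V hV hne => ?_⟩
  · rw [← iUnion_baireCantorPiece]
    exact e.surjective.iUnion_comp _
  · exact (infinite_baireCantorPiece_subset hV hne).preimage (by simp [e.surjective.range_eq])

/-! ### Borel sets as injective projections of closed sets -/

/-- A set is an injective closed projection if it is the image of a closed subset of the product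
with the Baire space under a projection that is injective on that subset. -/
def IsInjectiveClosedProjection {X : Type*} [TopologicalSpace X] (B : Set X) : Prop :=
  ∃ F : Set (X × (ℕ → ℕ)), IsClosed F ∧ InjOn Prod.fst F ∧ Prod.fst '' F = B

namespace IsInjectiveClosedProjection

variable {X : Type*} [TopologicalSpace X]

theorem _root_.IsClosed.isInjectiveClosedProjection {B : Set X} (hB : IsClosed B) :
    IsInjectiveClosedProjection B := by
  refine ⟨B ×ˢ {0}, hB.prod isClosed_singleton, ?_, fst_image_prod _ (singleton_nonempty _)⟩
  rintro ⟨x, w⟩ ⟨-, hw⟩ ⟨y, v⟩ ⟨-, hv⟩ (rfl : x = y)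
  exact Prod.ext rfl (hw.trans hv.symm)

/-- One sequence interleaves a witness for each `n` through `Nat.pair`; unique witnesses give a
unique interleaving. -/
theorem iInter {B : ℕ → Set X} (hB : ∀ n, IsInjectiveClosedProjection (B n)) :
    IsInjectiveClosedProjection (⋂ n, B n) := by
  choose F hF hinj himg using hB
  refine ⟨{p | ∀ n, (p.1, fun k => p.2 (Nat.pair n k)) ∈ F n}, ?_, ?_, ?_⟩
  · have h : {p : X × (ℕ → ℕ) | ∀ n, (p.1, fun k => p.2 (Nat.pair n k)) ∈ F n} =
        ⋂ n, (fun p : X × (ℕ → ℕ) => (p.1, fun k => p.2 (Nat.pair n k))) ⁻¹' F n := by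
      ext p
      simp
    rw [h]
    refine isClosed_iInter fun n => (hF n).preimage ?_
    exact continuous_fst.prodMk (continuous_pi fun k => (continuous_apply _).comp continuous_snd)
  · rintro ⟨x, w⟩ hw ⟨y, v⟩ hv (rfl : x = y)
    refine Prod.ext rfl (funext fun m => ?_)
    have h := congrFun (Prod.mk.inj (hinj m.unpair.1 (hw _) (hv _) rfl)).2 m.unpair.2
    simpa using h
  · ext x
    simp only [mem_iInter, ← himg]
    constructor
    · rintro ⟨⟨x, w⟩, hw, rfl⟩ n
      exact ⟨_, hw n, rfl⟩
    · intro h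
      choose p hp hpx using h
      refine ⟨(x, fun m => (p m.unpair.1).2 m.unpair.2), fun n => ?_, rfl⟩
      simp only [Nat.unpair_pair, ← hpx n]
      exact hp n

/-- The first term of the witness names the set containing the point; disjointness makes it unique.
-/
theorem iUnion {B : ℕ → Set X} (hB : ∀ n, IsInjectiveClosedProjection (B n))
    (hd : Pairwise (Disjoint on B)) : IsInjectiveClosedProjection (⋃ n, B n) := by
  choose F hF hinj himg using hB
  refine ⟨{p | (p.1, fun k => p.2 (1 + k)) ∈ F (p.2 0)}, ?_, ?_, ?_⟩
  · have h : {p : X × (ℕ → ℕ) | (p.1, fun k => p.2 (1 + k)) ∈ F (p.2 0)} =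
        ⋂ n, ((fun p : X × (ℕ → ℕ) => p.2 0) ⁻¹' {n}ᶜ ∪
          (fun p : X × (ℕ → ℕ) => (p.1, fun k => p.2 (1 + k))) ⁻¹' F n) := by
      ext p
      simp [← imp_iff_not_or]
    rw [h]
    refine isClosed_iInter fun n => .union ?_ ((hF n).preimage ?_)
    · exact (isClosed_discrete _).preimage ((continuous_apply 0).comp continuous_snd)
    · exact continuous_fst.prodMk ((continuous_tail 1).comp continuous_snd)
  · rintro ⟨x, w⟩ hw ⟨y, v⟩ hv (rfl : x = y)
    have h0 : w 0 = v 0 := by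
      by_contra hne
      have h1 : x ∈ Prod.fst '' F (w 0) := ⟨_, hw, rfl⟩
      have h2 : x ∈ Prod.fst '' F (v 0) := ⟨_, hv, rfl⟩
      rw [himg] at h1 h2
      exact disjoint_left.1 (hd hne) h1 h2
    have hv' : (x, fun k => v (1 + k)) ∈ F (w 0) := h0 ▸ hv
    have h := (Prod.mk.inj (hinj (w 0) hw hv' rfl)).2
    refine Prod.ext rfl (funext fun m => ?_)
    cases m with
    | zero => exact h0
    | succ m => simpa [add_comm] using congrFun h m
  · ext x
    simp only [mem_iUnion, ← himg]
    constructor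
    · rintro ⟨⟨x, w⟩, hw, rfl⟩
      exact ⟨w 0, _, hw, rfl⟩
    · rintro ⟨n, ⟨x, w⟩, hw, rfl⟩
      refine ⟨(x, seqCons n w), ?_, rfl⟩
      simpa [add_comm 1] using hw

end IsInjectiveClosedProjection

/-- Carrying the complement through the induction is what allows a union to be made disjoint, as
`iUnion` requires. -/
theorem MeasurableSet.isInjectiveClosedProjection {B : Set (ℕ → ℕ)} (hB : MeasurableSet B) :
    IsInjectiveClosedProjection B := by
  suffices h : IsInjectiveClosedProjection B ∧ IsInjectiveClosedProjection Bᶜ from h.1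
  have hgen : (MeasurableSpace.pi : MeasurableSpace (ℕ → ℕ)) = MeasurableSpace.generateFrom
      {s | ∃ (x : ℕ → ℕ) (n : ℕ), s = PiNat.cylinder x n} :=
    (BorelSpace.measurable_eq (α := ℕ → ℕ)).trans
      (PiNat.isTopologicalBasis_cylinders fun _ : ℕ => ℕ).borel_eq_generateFrom
  rw [hgen] at hB
  induction B, hB using MeasurableSpace.generateFrom_induction with
  | hC s hs _ =>
    obtain ⟨x, n, rfl⟩ := hs
    exact ⟨(isClosed_cylinder x n).isInjectiveClosedProjection,
      (PiNat.isOpen_cylinder _ x n).isClosed_compl.isInjectiveClosedProjection⟩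
  | empty =>
    rw [compl_empty]
    exact ⟨isClosed_empty.isInjectiveClosedProjection, isClosed_univ.isInjectiveClosedProjection⟩
  | compl s _ ih => exact ⟨ih.2, by rw [compl_compl]; exact ih.1⟩
  | iUnion f _ ih =>
    refine ⟨?_, by rw [compl_iUnion]; exact .iInter fun n => (ih n).2⟩
    set D : ℕ → Set (ℕ → ℕ) := fun n => ⋂ i, if i < n then (f i)ᶜ else f n with hD
    have hDf : ∀ {n x}, x ∈ D n → x ∈ f n := fun {n x} hx => by
      simpa using mem_iInter.1 hx n
    have hDlt : ∀ {n i x}, x ∈ D n → i < n → x ∉ f i := fun {n i x} hx hi => by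
      simpa [hi] using mem_iInter.1 hx i
    have hU : ⋃ n, f n = ⋃ n, D n := by
      refine subset_antisymm (fun x hx => ?_) (iUnion_mono fun n x hx => hDf hx)
      classical
      have hx' : ∃ n, x ∈ f n := mem_iUnion.1 hx
      refine mem_iUnion.2 ⟨Nat.find hx', mem_iInter.2 fun i => ?_⟩
      split_ifs with hi
      · exact Nat.find_min hx' hi
      · exact Nat.find_spec hx'
    rw [hU]
    refine .iUnion (fun n => .iInter fun i => ?_) fun m n hmn => disjoint_left.2 fun x hm hn => ?_
    · split_ifs
      · exact (ih i).2
      · exact (ih n).1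
    · rcases lt_or_gt_of_ne hmn with h | h
      · exact hDlt hn h (hDf hm)
      · exact hDlt hm h (hDf hn)

/-! ### Perfect subsets of the Baire space -/

/-- A perfect set, less one of its points, splits into infinitely many small perfect sets. -/
theorem Perfect.exists_split {V : Set (ℕ → ℕ)} (hV : Perfect V) (hne : V.Nonempty) (k : ℕ) :
    ∃ p, ∃ W : ℕ → Set (ℕ → ℕ), Pairwise (Disjoint on W) ∧
      (∀ n, Perfect (W n) ∧ (W n).Nonempty) ∧ (∀ n, W n ⊆ V) ∧
      (∀ n, ∃ x, W n ⊆ PiNat.cylinder x k) ∧ V \ {p} ⊆ ⋃ n, W n := by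
  obtain ⟨p, hp⟩ := hne
  have hacc : p ∈ closure (V \ {p}) := by
    have := hV.acc p hp
    rwa [accPt_principal_iff_clusterPt, ← mem_closure_iff_clusterPt] at this
  obtain ⟨q, hq⟩ := closure_nonempty_iff.1 ⟨p, hacc⟩
  have hcyl : ∀ x : ℕ → ℕ, ∃ n ≥ k, x ∈ ({p}ᶜ : Set (ℕ → ℕ)) → PiNat.cylinder x n ⊆ {p}ᶜ := by
    intro x
    by_cases hx : x ∈ ({p}ᶜ : Set (ℕ → ℕ))
    · obtain ⟨n, hn, h⟩ := exists_cylinder_subset (isOpen_compl_singleton.mem_nhds hx) k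
      exact ⟨n, hn, fun _ => h⟩
    · exact ⟨k, le_rfl, fun h => absurd h hx⟩
  choose N hNk hN using hcyl
  obtain ⟨t, htp, htc, htU⟩ := TopologicalSpace.countable_cover_nhdsWithin (s := {p}ᶜ)
    (f := fun x => PiNat.cylinder x (N x)) fun x _ =>
      mem_nhdsWithin_of_mem_nhds (cylinder_mem_nhds x (N x))
  have htne : t.Nonempty := by
    obtain ⟨x, hx, -⟩ := mem_iUnion₂.1 (htU (show q ∈ ({p}ᶜ : Set (ℕ → ℕ)) from hq.2))
    exact ⟨x, hx⟩
  obtain ⟨x, rfl⟩ := htc.exists_eq_range htne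
  set c : ℕ → Set (ℕ → ℕ) := fun i => PiNat.cylinder (x i) (N (x i)) with hc
  have hcover : ∀ y ≠ p, ∃ i, y ∈ disjointed c i := by
    intro y hy
    have h : y ∈ ⋃ i, c i := by simpa [hc] using htU (show y ∈ ({p}ᶜ : Set (ℕ → ℕ)) from hy)
    rw [← iUnion_disjointed] at h
    exact mem_iUnion.1 h
  have hpc : ∀ i, p ∉ disjointed c i := fun i hi =>
    hN (x i) (htp (mem_range_self i)) (disjointed_subset c i hi) rfl
  have hclopen : ∀ i, IsClopen (disjointed c i) := fun i =>
    disjointedRec (p := IsClopen) (fun s j hs => hs.diff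
      ⟨isClosed_cylinder _ _, PiNat.isOpen_cylinder _ _ _⟩)
      ⟨isClosed_cylinder _ _, PiNat.isOpen_cylinder _ _ _⟩
  -- Finitely many clopen pieces would have a closed union containing `V \ {p}` but missing its
  -- accumulation point `p`.
  have hinf : {i | (V ∩ disjointed c i).Nonempty}.Infinite := by
    intro hfin
    have hsub : V \ {p} ⊆ ⋃ i ∈ {i | (V ∩ disjointed c i).Nonempty}, disjointed c i := by
      rintro y ⟨hyV, hyp⟩
      obtain ⟨i, hi⟩ := hcover y hyp
      exact mem_biUnion (show i ∈ {i | (V ∩ disjointed c i).Nonempty} from ⟨y, hyV, hi⟩) hi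
    have hcl := closure_minimal hsub (hfin.isClosed_biUnion fun i _ => (hclopen i).1) hacc
    obtain ⟨i, -, hi⟩ := mem_iUnion₂.1 hcl
    exact hpc i hi
  set a : ℕ → ℕ := Nat.nth (· ∈ {i | (V ∩ disjointed c i).Nonempty}) with ha
  refine ⟨p, fun n => V ∩ disjointed c (a n), fun m n hmn => ?_, fun n => ⟨⟨?_, ?_⟩, ?_⟩,
    fun n => inter_subset_left, fun n => ⟨x (a n), ?_⟩, ?_⟩
  · exact (disjoint_disjointed c ((Nat.nth_injective hinf).ne hmn)).mono inter_subset_right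
      inter_subset_right
  · exact hV.closed.inter (hclopen _).1
  · show Preperfect (V ∩ disjointed c (a n))
    rw [inter_comm]
    exact hV.acc.open_inter (hclopen _).2
  · exact Nat.nth_mem_of_infinite hinf n
  · exact inter_subset_right.trans ((disjointed_subset c _).trans (PiNat.cylinder_anti _ (hNk _)))
  · rintro y ⟨hyV, hyp⟩
    obtain ⟨i, hi⟩ := hcover y hyp
    have hmem : i ∈ range a := by
      have h : range a = {i | (V ∩ disjointed c i).Nonempty} := Nat.range_nth_of_infinite hinf
      rw [h]
      exact ⟨y, hyV, hi⟩
    obtain ⟨n, rfl⟩ := hmem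
    exact mem_iUnion.2 ⟨n, hyV, hi⟩

open PiNat (res res_succ res_zero res_length res_eq_res)

/-- A nonempty perfect subset of the Baire space is, up to a countable set, an injective continuous
image of the Baire space. -/
theorem Perfect.exists_isInjectiveBaireImage {D : Set (ℕ → ℕ)} (hD : Perfect D)
    (hne : D.Nonempty) : ∃ A ⊆ D, IsInjectiveBaireImage A ∧ (D \ A).Countable := by
  have hsplit : ∀ (V : {V : Set (ℕ → ℕ) // Perfect V ∧ V.Nonempty}) (k : ℕ), ∃ p,
      ∃ W : ℕ → {V : Set (ℕ → ℕ) // Perfect V ∧ V.Nonempty},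
      (∀ m n, m ≠ n → Disjoint (W m).1 (W n).1) ∧ (∀ n, (W n).1 ⊆ V.1) ∧
      (∀ n, ∃ x, (W n).1 ⊆ PiNat.cylinder x k) ∧ V.1 \ {p} ⊆ ⋃ n, (W n).1 := by
    rintro ⟨V, hV, hVne⟩ k
    obtain ⟨p, W, h1, h2, h3, h4, h5⟩ := hV.exists_split hVne k
    exact ⟨p, fun n => ⟨W n, h2 n⟩, fun m n hmn => h1 hmn, h3, h4, h5⟩
  choose p W hdisj hsub hsmall hcov using hsplit
  -- A tree of perfect sets indexed by finite sequences, most recent term first as in `res`. The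
  -- sets of level `n + 1` lie in cylinders of length `n + 1`, so each branch shrinks to one point.
  set A : List ℕ → {V : Set (ℕ → ℕ) // Perfect V ∧ V.Nonempty} := fun l =>
    List.rec ⟨D, hD, hne⟩ (fun n l V => W V (l.length + 1) n) l with hA
  have hAnil : (A []).1 = D := rfl
  have hAcons : ∀ n l, A (n :: l) = W (A l) (l.length + 1) n := fun n l => rfl
  have hanti : ∀ z : ℕ → ℕ, Antitone fun n => (A (res z n)).1 := fun z =>
    antitone_nat_of_succ_le fun n => hsub _ _ _
  have hagree : ∀ (z : ℕ → ℕ) (n : ℕ), ∀ x ∈ (A (res z n)).1, ∀ y ∈ (A (res z n)).1,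
      ∀ i < n, x i = y i := by
    intro z n x hx y hy i hi
    cases n with
    | zero => exact absurd hi i.not_lt_zero
    | succ n =>
      rw [res_succ, hAcons] at hx hy
      obtain ⟨c, hc⟩ := hsmall (A (res z n)) ((res z n).length + 1) (z n)
      rw [res_length] at *
      rw [hc hx i hi, hc hy i hi]
  have hlim : ∀ z : ℕ → ℕ, ∃ x, ∀ n, x ∈ (A (res z n)).1 := by
    intro z
    choose y hy using fun n => (A (res z n)).2.2
    -- All points of level `k + 1` agree at the term `k`, so the diagonal is the limit of the `y n`.
    refine ⟨fun k => y (k + 1) k, fun n => ?_⟩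
    rw [← (A (res z n)).2.1.closed.closure_eq, mem_closure_iff_nhds]
    intro U hU
    obtain ⟨m, -, hm⟩ := exists_cylinder_subset hU 0
    refine ⟨y (max m n), hm fun i hi => ?_, hanti z (le_max_right m n) (hy _)⟩
    exact hagree z (i + 1) _ (hanti z (hi.trans_le (le_max_left m n)) (hy _)) _ (hy (i + 1)) i
      i.lt_succ_self
  choose f hf using hlim
  refine ⟨range f, range_subset_iff.2 fun z => hf z 0, ⟨f, ?_, ?_, rfl⟩, ?_⟩
  · refine continuous_iff_continuousAt.2 fun z U hU => ?_
    obtain ⟨n, -, hn⟩ := exists_cylinder_subset hU 0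
    refine mem_map.2 (mem_of_superset (cylinder_mem_nhds z n) fun w hw => hn fun i hi => ?_)
    have hres : res w n = res z n := res_eq_res.2 fun {m} hm => hw m hm
    exact hagree z n _ (hres ▸ hf w n) _ (hf z n) i hi
  · intro z w h
    by_contra hne
    obtain ⟨n, hn, hlt⟩ := exists_first_index (p := fun a : Prop => a)
      (z := fun n => z n ≠ w n) (by simpa [funext_iff] using hne)
    have hres : res w n = res z n := res_eq_res.2 fun {m} hm => (not_not.1 (hlt m hm)).symm
    have h1 := hf z (n + 1)
    have h2 := hf w (n + 1)
    rw [res_succ, hAcons] at h1 h2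
    rw [hres, ← h] at h2
    exact disjoint_left.1 (hdisj _ _ _ _ hn) h1 h2
  -- Only the point omitted at each node can be lost, and the tree has countably many nodes; any
  -- other point of `D` follows a branch.
  · refine (countable_range fun l : List ℕ => p (A l) (l.length + 1)).mono ?_
    rintro x ⟨hxD, hx⟩
    by_contra hxp
    refine hx ?_
    have hnext : ∀ l, ∃ n, x ∈ (A l).1 → x ∈ (A (n :: l)).1 := fun l => by
      by_cases hxl : x ∈ (A l).1
      · obtain ⟨n, hn⟩ := mem_iUnion.1 (hcov (A l) (l.length + 1)
          ⟨hxl, fun h => hxp ⟨l, (mem_singleton_iff.1 h).symm⟩⟩)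
        exact ⟨n, fun _ => hn⟩
      · exact ⟨0, fun h => absurd h hxl⟩
    choose a ha using hnext
    set b : ℕ → List ℕ := fun k => Nat.rec [] (fun _ l => a l :: l) k with hb
    have hres : ∀ k, res (fun k => a (b k)) k = b k := fun k => by
      induction k with
      | zero => rfl
      | succ k ih => rw [res_succ, ih]
    have hxb : ∀ k, x ∈ (A (b k)).1 := fun k => by
      induction k with
      | zero => exact hxD
      | succ k ih => exact ha _ ih
    refine ⟨fun k => a (b k), funext fun i => ?_⟩
    exact hagree _ (i + 1) _ (hf _ (i + 1)) _ (by rw [hres]; exact hxb (i + 1)) i i.lt_succ_self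

/-! ### Absolute Borel spaces -/

/-- A standard Borel metrizable space is a bijective continuous image of a Borel subset of the
Baire space. -/
theorem exists_measurableSet_continuous_bijective (X : Type*) [TopologicalSpace X]
    [TopologicalSpace.MetrizableSpace X] [SecondCountableTopology X] [MeasurableSpace X]
    [BorelSpace X] [StandardBorelSpace X] :
    ∃ (B : Set (ℕ → ℕ)) (r : B → X), MeasurableSet B ∧ Continuous r ∧ Bijective r := by
  classical
  -- Adding `∅` makes the basis nonempty even for empty `X`, so that a sequence can enumerate it.
  have hbasis := (TopologicalSpace.isBasis_countableBasis X).insert_empty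
  obtain ⟨b, hb⟩ := ((TopologicalSpace.countable_countableBasis X).insert ∅).exists_eq_range
    (insert_nonempty _ _)
  rw [hb] at hbasis
  have hopen : ∀ n, IsOpen (b n) := fun n => hbasis.isOpen (mem_range_self n)
  -- The code is only Borel, but its inverse is continuous: a single term decides membership in a
  -- basic open set.
  set code : X → ℕ → ℕ := fun x n => if x ∈ b n then 1 else 0 with hcode
  have hmeas : Measurable code := measurable_pi_iff.2 fun n =>
    Measurable.ite (hopen n).measurableSet measurable_const measurable_const
  have hmem : ∀ x n, code x n = 1 ↔ x ∈ b n := fun x n => by simp [hcode]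
  have hinj : Injective code := fun x y h => hbasis.eq_iff.2 <| by
    rintro _ ⟨n, rfl⟩
    rw [← hmem, ← hmem, h]
  refine ⟨range code, (Equiv.ofInjective code hinj).symm,
    (hmeas.measurableEmbedding hinj).measurableSet_range, ?_, Equiv.bijective _⟩
  refine continuous_iff_continuousAt.2 fun z U hU => ?_
  obtain ⟨x, rfl⟩ := (Equiv.ofInjective code hinj).surjective z
  rw [Equiv.symm_apply_apply] at hU
  obtain ⟨_, ⟨n, rfl⟩, hx, hn⟩ := hbasis.mem_nhds_iff.1 hU
  have hV : IsOpen {w : range code | w.1 n = 1} := (isOpen_discrete {1}).preimage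
    ((continuous_apply n).comp continuous_subtype_val)
  refine mem_map.2 (mem_of_superset (hV.mem_nhds ((hmem x n).2 hx)) fun w hw => ?_)
  obtain ⟨y, rfl⟩ := (Equiv.ofInjective code hinj).surjective w
  rw [mem_preimage, Equiv.symm_apply_apply]
  exact hn ((hmem y n).1 hw)

theorem IsAbsoluteBorelSpace.exists_continuous_bijective {Y : Type u} [TopologicalSpace Y]
    (hY : IsAbsoluteBorelSpace Y) :
    ∃ (B : Set (ℕ → ℕ)) (r : B → Y), MeasurableSet B ∧ Continuous r ∧ Bijective r := by
  obtain ⟨P, _, _, s, hs, ⟨e⟩⟩ := hY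
  borelize P
  have := hs.standardBorel
  obtain ⟨B, r, hB, hr, hbij⟩ := exists_measurableSet_continuous_bijective s
  exact ⟨B, e.symm ∘ r, hB, e.symm.continuous.comp hr, e.symm.bijective.comp hbij⟩

/-- An absolute Borel space that is not countable is, up to a countable set, an injective continuous
image of the Baire space. -/
theorem IsAbsoluteBorelSpace.exists_isInjectiveBaireImage {Y : Type u} [TopologicalSpace Y]
    (hY : IsAbsoluteBorelSpace Y) (hunc : ¬ (univ : Set Y).Countable) :
    ∃ A : Set Y, IsInjectiveBaireImage A ∧ Aᶜ.Countable := by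
  obtain ⟨B, r, hB, hr, hbij⟩ := hY.exists_continuous_bijective
  obtain ⟨F, hF, hinj, hFB⟩ := hB.isInjectiveClosedProjection
  set θ : (ℕ → ℕ) → (ℕ → ℕ) × (ℕ → ℕ) := fun z => (fun k => z (2 * k), fun k => z (2 * k + 1))
    with hθ
  have hθc : Continuous θ := (continuous_pi fun k => continuous_apply (2 * k)).prodMk
    (continuous_pi fun k => continuous_apply (2 * k + 1))
  have hθi : Injective θ := fun z w h => by
    obtain ⟨h1, h2⟩ := Prod.mk.inj h
    funext k
    obtain ⟨m, rfl | rfl⟩ := Nat.even_or_odd' k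
    · exact congrFun h1 m
    · exact congrFun h2 m
  have hθs : Surjective θ := fun p => by
    refine ⟨fun k => if Even k then p.1 (k / 2) else p.2 (k / 2), Prod.ext ?_ ?_⟩
    · funext k
      simp [hθ]
    · funext k
      have : (2 * k + 1) / 2 = k := by omega
      simp [hθ, this]
  have hmemB : ∀ z : θ ⁻¹' F, (θ z).1 ∈ B := fun z => hFB ▸ mem_image_of_mem _ z.2
  -- Interleaving by `θ` moves the closed set of pairs into the Baire space, so that `q` is a
  -- continuous bijection from a closed set onto `Y`.
  set q : θ ⁻¹' F → Y := fun z => r ⟨(θ z).1, hmemB z⟩ with hq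
  have hqc : Continuous q := hr.comp
    ((continuous_fst.comp (hθc.comp continuous_subtype_val)).subtype_mk _)
  have hqi : Injective q := fun z w h => by
    have h1 : (θ z).1 = (θ w).1 := congrArg Subtype.val (hbij.1 h)
    exact Subtype.ext (hθi (hinj z.2 w.2 h1))
  have hqs : Surjective q := fun y => by
    obtain ⟨⟨x, hx⟩, rfl⟩ := hbij.2 y
    obtain ⟨p, hp, rfl⟩ := hFB.symm ▸ hx
    obtain ⟨z, rfl⟩ := hθs p
    exact ⟨⟨z, hp⟩, rfl⟩
  -- Cantor–Bendixson: a countable part and a perfect part, the latter nonempty because `Y` is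
  -- uncountable.
  obtain ⟨V, D, hV, hD, hVD⟩ := exists_countable_union_perfect_of_isClosed (hF.preimage hθc)
  have hDne : D.Nonempty := by
    rw [nonempty_iff_ne_empty]
    rintro rfl
    rw [union_empty] at hVD
    have : Countable (θ ⁻¹' F) := by
      rw [hVD]
      exact hV.to_subtype
    refine hunc ?_
    rw [← hqs.range_eq]
    exact countable_range q
  obtain ⟨A, hAD, ⟨f, hf, hfi, rfl⟩, hcount⟩ := hD.exists_isInjectiveBaireImage hDne
  have hfF : ∀ z, f z ∈ θ ⁻¹' F := fun z => hVD ▸ Or.inr (hAD (mem_range_self z))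
  refine ⟨range fun z => q ⟨f z, hfF z⟩, ⟨_, hqc.comp (hf.subtype_mk _), fun z w h =>
    hfi (congrArg Subtype.val (hqi h)), rfl⟩, ?_⟩
  have hc : ((↑) ⁻¹' (V ∪ D \ range f) : Set (θ ⁻¹' F)).Countable :=
    (hV.union hcount).preimage_of_injOn Subtype.val_injective.injOn
  refine (hc.image q).mono fun y hy => ?_
  obtain ⟨z, rfl⟩ := hqs y
  refine mem_image_of_mem q ?_
  have hz : (z : ℕ → ℕ) ∈ V ∪ D := hVD ▸ z.2
  refine hz.imp_right fun hzD => ⟨hzD, ?_⟩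
  rintro ⟨w, hw⟩
  exact hy ⟨w, congrArg q (Subtype.ext hw)⟩

/-! ### Absorbing the countable remainder -/

/-- If a metrizable space has no nonempty countable open subset and is, up to a countable set, an
injective continuous image of the Baire space, then it is such an image. -/
theorem IsInjectiveBaireImage.univ_of_countable_compl {Y : Type u} [TopologicalSpace Y]
    [TopologicalSpace.MetrizableSpace Y] (hY : ∀ U : Set Y, IsOpen U → U.Nonempty → ¬ U.Countable)
    {A : Set Y} (hA : IsInjectiveBaireImage A) (hAc : Aᶜ.Countable) :
    IsInjectiveBaireImage (univ : Set Y) := by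
  obtain ⟨g, hg, hgi, rfl⟩ := hA
  obtain ⟨e⟩ := nonempty_equiv_of_countable (α := ℕ × Bool) (β := ℕ)
  -- Splitting each term into a number and a bit replaces the Baire space by its product with the
  -- Cantor space, where the partition lives.
  set h : (ℕ → ℕ) × (ℕ → Bool) → Y := fun p => g fun k => e (p.1 k, p.2 k) with hh
  have hc : Continuous h := hg.comp <| continuous_pi fun k =>
    (continuous_of_discreteTopology (f := e)).comp
      (((continuous_apply k).comp continuous_fst).prodMk ((continuous_apply k).comp continuous_snd))
  have hi : Injective h := fun p q hpq => by
    have h1 : ∀ k, (p.1 k, p.2 k) = (q.1 k, q.2 k) := fun k => e.injective (congrFun (hgi hpq) k)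
    exact Prod.ext (funext fun k => (Prod.mk.inj (h1 k)).1) (funext fun k => (Prod.mk.inj (h1 k)).2)
  have hr : range h = range g := by
    refine subset_antisymm (range_subset_iff.2 fun p => mem_range_self _) ?_
    rintro _ ⟨z, rfl⟩
    exact ⟨(fun k => (e.symm (z k)).1, fun k => (e.symm (z k)).2), by simp [hh]⟩
  rw [← hr] at hAc
  clear_value h
  obtain ⟨T, hT, hTd, hTu, hTV⟩ := exists_partition_baireCantor
  have : Countable ((range h)ᶜ : Set Y) := hAc.to_subtype
  have := Encodable.ofCountable ((range h)ᶜ : Set Y)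
  choose N hN using fun c : Y => (𝓝 c).exists_antitone_basis
  -- A neighborhood of a missing point is uncountable, so it meets `range h`, and its open preimage
  -- contains infinitely many pieces. Numbers `m` that code no pair impose no condition.
  have hinf : ∀ m : ℕ, ∃ᶠ k in atTop, ∀ q : ((range h)ᶜ : Set Y) × ℕ, Encodable.encode q = m →
      T k ⊆ h ⁻¹' interior (N q.1 q.2) := by
    intro m
    rw [Nat.frequently_atTop_iff_infinite]
    by_cases hm : ∃ q : ((range h)ᶜ : Set Y) × ℕ, Encodable.encode q = m
    · obtain ⟨q, rfl⟩ := hm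
      refine (hTV (h ⁻¹' interior (N q.1 q.2)) (isOpen_interior.preimage hc) ?_).mono ?_
      · by_contra hne
        refine hY (interior (N q.1 q.2)) isOpen_interior
          ⟨q.1, mem_interior_iff_mem_nhds.2 ((hN q.1).1.mem_of_mem trivial)⟩ (hAc.mono ?_)
        rintro y hy ⟨p, rfl⟩
        exact hne ⟨p, hy⟩
      · intro k hk q' hq'
        rw [Encodable.encode_injective hq']
        exact hk
    · refine infinite_univ.mono fun k _ q hq => absurd ⟨q, hq⟩ hm
  -- A strictly increasing choice gives distinct pairs `(c, n)` distinct pieces.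
  obtain ⟨φ, hφ, hφT⟩ := extraction_forall_of_frequently hinf
  set idx : ((range h)ᶜ : Set Y) × ℕ → ℕ := fun q => φ (Encodable.encode q) with hidx
  have hidxi : Injective idx := hφ.injective.comp Encodable.encode_injective
  have hidxT : ∀ q, h '' T (idx q) ⊆ N q.1 q.2 := fun q =>
    image_subset_iff.2 ((hφT _ q rfl).trans (preimage_mono interior_subset))
  have hTd' : Pairwise (Disjoint on fun i => h '' T i) := fun i j hij =>
    (disjoint_image_iff hi).2 (hTd hij)
  have hTr : ∀ i, h '' T i ⊆ range h := fun i => image_subset_range _ _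
  -- Each missing point joins the pieces chosen to converge to it; the unused pieces stay alone.
  set B : ((range h)ᶜ : Set Y) ⊕ {i // i ∉ range idx} → Set Y :=
    Sum.elim (fun c => insert c.1 (⋃ n, h '' T (idx (c, n)))) fun i => h '' T i with hB
  have hBU : ⋃ j, B j = univ := by
    refine eq_univ_of_forall fun y => mem_iUnion.2 ?_
    by_cases hy : y ∈ range h
    · obtain ⟨p, rfl⟩ := hy
      obtain ⟨i, hp⟩ := mem_iUnion.1 (hTu.symm ▸ mem_univ p)
      by_cases hir : i ∈ range idx
      · obtain ⟨⟨c, n⟩, rfl⟩ := hir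
        exact ⟨.inl c, Or.inr (mem_iUnion.2 ⟨n, p, hp, rfl⟩)⟩
      · exact ⟨.inr ⟨i, hir⟩, p, hp, rfl⟩
    · exact ⟨.inl ⟨y, hy⟩, Or.inl rfl⟩
  have : Nonempty (((range h)ᶜ : Set Y) ⊕ {i // i ∉ range idx}) := by
    obtain ⟨j, -⟩ := mem_iUnion.1 (hBU.symm ▸ mem_univ (h 0))
    exact ⟨j⟩
  rw [← hBU]
  refine iUnion (fun j => ?_) fun j j' hjj => ?_
  · rcases j with c | i
    · refine insert_iUnion (fun n => (hT _).image hc hi)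
        (fun m n hmn => ?_) (fun n hcn => c.2 (hTr _ hcn)) ?_
      · have hne : idx (c, m) ≠ idx (c, n) := fun h => hmn (Prod.mk.inj (hidxi h)).2
        have hd := hTd' hne
        exact hd
      intro U hU
      obtain ⟨n, -, hn⟩ := (hN c).1.mem_iff.1 hU
      filter_upwards [eventually_ge_atTop n] with m hm
      exact (hidxT (c, m)).trans (((hN c).2 hm).trans hn)
    · exact (hT _).image hc hi
  · refine disjoint_left.2 fun y hy hy' => ?_
    have key : ∀ i i', y ∈ h '' T i → y ∈ h '' T i' → i = i' := fun i i' h1 h2 => by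
      by_contra hne
      exact disjoint_left.1 (hTd' hne) h1 h2
    rcases j with c | i <;> rcases j' with c' | i'
    · rcases hy with rfl | hy <;> rcases hy' with hy' | hy'
      · exact hjj (congrArg Sum.inl (Subtype.ext hy'))
      · obtain ⟨n, hn⟩ := mem_iUnion.1 hy'
        exact c.2 (hTr _ hn)
      · obtain ⟨n, hn⟩ := mem_iUnion.1 hy
        exact c'.2 (hy' ▸ hTr _ hn)
      · obtain ⟨n, hn⟩ := mem_iUnion.1 hy
        obtain ⟨n', hn'⟩ := mem_iUnion.1 hy'
        exact hjj (congrArg Sum.inl (Prod.mk.inj (hidxi (key _ _ hn hn'))).1)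
    · rcases hy with rfl | hy
      · exact c.2 (hTr _ hy')
      · obtain ⟨n, hn⟩ := mem_iUnion.1 hy
        exact i'.2 ⟨_, key _ _ hn hy'⟩
    · rcases hy' with rfl | hy'
      · exact c'.2 (hTr _ hy)
      · obtain ⟨n, hn⟩ := mem_iUnion.1 hy'
        exact i.2 ⟨_, key _ _ hn hy⟩
    · exact hjj (congrArg Sum.inr (Subtype.ext (key _ _ hy hy')))

/-! ### Transfer to the Sorgenfrey line and conclusion -/

theorem exists_continuous_bijective_sorgenfreyLine {Y : Type u} [TopologicalSpace Y]
    [TopologicalSpace.MetrizableSpace Y] [Nonempty Y] (hB : IsAbsoluteBorelSpace Y)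
    (hY : ∀ U : Set Y, IsOpen U → U.Nonempty → ¬ U.Countable) :
    ∃ f : SorgenfreyLine → Y, Continuous f ∧ Bijective f := by
  obtain ⟨A, hA, hAc⟩ := hB.exists_isInjectiveBaireImage (hY univ isOpen_univ univ_nonempty)
  obtain ⟨f, hf, hfi, hfr⟩ := IsInjectiveBaireImage.univ_of_countable_compl hY hA hAc
  exact ⟨f ∘ SorgenfreyLine.expansion, hf.comp SorgenfreyLine.continuous_expansion,
    Bijective.comp ⟨hfi, range_eq_univ.1 hfr⟩ SorgenfreyLine.expansion_bijective⟩

theorem corollary3p9 (Y : Type u) [TopologicalSpace Y] [TopologicalSpace.MetrizableSpace Y] :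
    ((∃ f : SorgenfreyLine → Y, Continuous f ∧ Function.Surjective f) ↔
      (Nonempty Y ∧ IsAnalyticSpace Y)) ∧
    ((∃ f : SorgenfreyLine → Y, Continuous f ∧ Function.Bijective f) ↔
      (Nonempty Y ∧ IsAbsoluteBorelSpace Y ∧
        ∀ U : Set Y, IsOpen U → U.Nonempty → ¬ U.Countable)) ∧
    ((∃ f : SorgenfreyLine → Y, Continuous f ∧ IsQuotientMap f) ↔
      (Nonempty Y ∧ IsAnalyticSpace Y)) ∧
    ((∃ f : SorgenfreyLine → Y, Continuous f ∧ IsBiquotientMap f) ↔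
      (Nonempty Y ∧ IsAnalyticSpace Y)) ∧
    ((∃ f : SorgenfreyLine → Y, Continuous f ∧ IsPseudoOpenMap f) ↔
      (Nonempty Y ∧ IsAnalyticSpace Y)) := by
  have hfwd : ∀ f : SorgenfreyLine → Y, Continuous f → Surjective f →
      Nonempty Y ∧ IsAnalyticSpace Y := fun f hf hs =>
    ⟨⟨f (SorgenfreyLine.ofReal 0)⟩, isAnalyticSpace_of_continuous_surjective hf hs⟩
  have hbwd : Nonempty Y ∧ IsAnalyticSpace Y →
      ∃ f : SorgenfreyLine → Y, Continuous f ∧ IsAlmostOpenMap f := fun ⟨_, h⟩ =>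
    exists_continuous_isAlmostOpenMap h
  refine ⟨⟨fun ⟨f, hf, hs⟩ => hfwd f hf hs, fun h => ?_⟩, ⟨fun ⟨f, hf, hb⟩ => ?_, ?_⟩,
    ⟨fun ⟨f, hf, hs⟩ => hfwd f hf hs.surjective, fun h => ?_⟩,
    ⟨fun ⟨f, hf, hs⟩ => hfwd f hf hs.surjective, fun h => ?_⟩,
    ⟨fun ⟨f, hf, hs⟩ => hfwd f hf hs.surjective, fun h => ?_⟩⟩
  · exact (hbwd h).imp fun f hf => ⟨hf.1, hf.2.surjective⟩
  · exact ⟨(hfwd f hf hb.2).1, isAbsoluteBorelSpace_of_continuous_bijective hf hb,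
      fun U hU hne => not_countable_of_continuous_bijective hf hb hU hne⟩
  · rintro ⟨_, hB, hY⟩
    exact exists_continuous_bijective_sorgenfreyLine hB hY
  · exact (hbwd h).imp fun f hf => ⟨hf.1, hf.2.isQuotientMap hf.1⟩
  · exact (hbwd h).imp fun f hf => ⟨hf.1, hf.2.isBiquotientMap⟩
  · exact (hbwd h).imp fun f hf => ⟨hf.1, hf.2.isPseudoOpenMap⟩
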